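/- Let $q\in[1,+\infty)$ and let $\Lambda=(\lambda_n)_{n\ge 0}$ be a quasi-geometric sequence: $\lambda_n>0$ and there are constants $r,R$ with $1<r\le \lambda_{n+1}/\lambda_n\le R<+\infty$ for all $n$. Let $M_\Lambda^q$ be the closed linear span of the monomials $t^{\lambda_n}$ in the complex space $L^q([0,1],m)$, where $m$ is the Lebesgue measure. A finite positive Borel measure $\mu$ on $[0,1)$ is called a Carleson measure for $M_\Lambda^q$ if there is a constant $C$ with $\|f\|_{L^q(\mu)}\le C\|f\|_{L^q(m)}$ for every Müntz polynomial $f(t)=\sum_n a_nt^{\lambda_n}$ (finite sum, $a_n\in\mathbb{C}$); then $i_\mu^q:M_\Lambda^q\to L^q(\mu)$, $f\mapsto f$, denotes the bounded embedding operator (the unique bounded operator that sends each Müntz polynomial to itself), and $\|i_\mu^q\|_e=\inf\{\|i_\mu^q-K\| : K:M_\Lambda^q\to L^q(\mu)\text{ compact}\}$ is its essential norm. For $n\ge0$ put $$D_n(q)=\Big(\int_{[0,1)}\lambda_n^{\frac1q}t^{\lambda_n}\Big(\sum_{k\ge0}\lambda_k^{\frac1q}t^{\lambda_k}\Big)^{q-1}d\mu(t)\Big)^{\frac1q}\in[0,+\infty].$$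 Then there is a constant $C\in(0,+\infty)$, depending only on $q$ and $\Lambda$, such that for every finite positive Borel measure $\mu$ on $[0,1)$ that is a Carleson measure for $M_\Lambda^q$, $$\|i_\mu^q\|_e\approx\limsup_{n\to+\infty}\Big(\lambda_n\int_{[0,1)}t^{\lambda_n}d\mu\Big)^{\frac1q}\approx\Big(\limsup_{\varepsilon\to0^+}\frac{\mu([1-\varepsilon,1))}{\varepsilon}\Big)^{\frac1q}\approx\limsup_{n\to+\infty}D_n(q),$$ where $A\approx B$ means $A\le CB$ and $B\le CA$. Moreover, for every such $\mu$, the operator $i_\mu^q$ is compact if and only if $\mu$ is vanishing sublinear, that is, $\lim_{\varepsilon\to0^+}\mu([1-\varepsilon,1))/\varepsilon=0$. -/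

import Mathlib

open MeasureTheory Filter Topology
open scoped ENNReal NNReal

noncomputable section

namespace Muntz

/-- The half-open interval `[0,1)`, as a type. The point `1` is Lebesgue-null, so that
`L^q([0,1], m) = L^q([0,1), m)`. -/
abbrev Unit01 : Type := Set.Ico (0 : ℝ) 1

/-- A sequence of positive numbers is quasi-geometric if its consecutive ratios stay between two
constants `r` and `R` with `1 < r ≤ R < ∞`. -/
def IsQuasiGeometric (Λ : ℕ → ℝ≥0) : Prop :=
  (∀ n, 0 < Λ n) ∧ ∃ r R : ℝ≥0, 1 < r ∧ ∀ n, r ≤ Λ (n + 1) / Λ n ∧ Λ (n + 1) / Λ n ≤ R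

/-- The Lebesgue measure `m` on `[0,1)`. -/
def lebesgue : Measure Unit01 := Measure.comap Subtype.val volume

instance isFiniteMeasure_lebesgue : IsFiniteMeasure lebesgue := by
  refine ⟨?_⟩
  rw [lebesgue, (MeasurableEmbedding.subtype_coe measurableSet_Ico).comap_apply,
    Set.image_univ, Subtype.range_coe]
  simp

/-- The monomial `t ↦ t ^ a` on `[0,1)`, complex-valued. -/
def monomialFun (a : ℝ≥0) (t : Unit01) : ℂ := (((t : ℝ) ^ (a : ℝ) : ℝ) : ℂ)

theorem memLp_monomialFun (q : ℝ≥0∞) (ν : Measure Unit01) [IsFiniteMeasure ν] (a : ℝ≥0) :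
    MemLp (monomialFun a) q ν := by
  have hc : Continuous (monomialFun a) :=
    Complex.continuous_ofReal.comp
      (continuous_subtype_val.rpow_const fun _ => Or.inr a.coe_nonneg)
  refine MemLp.of_bound hc.aestronglyMeasurable 1 (Eventually.of_forall fun t => ?_)
  rw [monomialFun, Complex.norm_real, Real.norm_of_nonneg (Real.rpow_nonneg t.2.1 _)]
  exact Real.rpow_le_one t.2.1 t.2.2.le a.coe_nonneg

/-- The monomial `t ↦ t ^ a` as an element of `L^q(ν)`. -/
def monomialLp (q : ℝ≥0∞) (ν : Measure Unit01) [IsFiniteMeasure ν] (a : ℝ≥0) : Lp ℂ q ν :=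
  (memLp_monomialFun q ν a).toLp (monomialFun a)

/-- The Müntz polynomial `∑ n, b n • t ^ (Λ n)`, for finitely supported coefficients `b`, as an
element of `L^q(ν)`. -/
def muntzPoly (q : ℝ≥0∞) (Λ : ℕ → ℝ≥0) (ν : Measure Unit01) [IsFiniteMeasure ν] :
    (ℕ →₀ ℂ) →ₗ[ℂ] Lp ℂ q ν :=
  Finsupp.linearCombination ℂ fun n => monomialLp q ν (Λ n)

/-- The Müntz space `M_Λ^q`: the closed linear span in `L^q(m)` of the monomials `t ^ (Λ n)`. -/
def muntzSpace (q : ℝ≥0∞) [Fact (1 ≤ q)] (Λ : ℕ → ℝ≥0) :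
    Submodule ℂ (Lp ℂ q (lebesgue : Measure Unit01)) :=
  (Submodule.span ℂ (Set.range fun n => monomialLp q lebesgue (Λ n))).topologicalClosure

theorem muntzPoly_mem (q : ℝ≥0∞) [Fact (1 ≤ q)] (Λ : ℕ → ℝ≥0) (b : ℕ →₀ ℂ) :
    muntzPoly q Λ lebesgue b ∈ muntzSpace q Λ := by
  refine Submodule.le_topologicalClosure _ ?_
  rw [← Finsupp.range_linearCombination]
  exact ⟨b, rfl⟩

/-- Müntz polynomials as elements of the Müntz space. -/
def toMuntzSpace (q : ℝ≥0∞) [Fact (1 ≤ q)] (Λ : ℕ → ℝ≥0) : (ℕ →₀ ℂ) →ₗ[ℂ] muntzSpace q Λ :=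
  (muntzPoly q Λ lebesgue).codRestrict (muntzSpace q Λ) (muntzPoly_mem q Λ)

theorem denseRange_toMuntzSpace (q : ℝ≥0∞) [Fact (1 ≤ q)] (Λ : ℕ → ℝ≥0) :
    DenseRange (toMuntzSpace q Λ) := by
  intro x
  rw [Topology.IsInducing.subtypeVal.closure_eq_preimage_closure_image, Set.mem_preimage,
    ← Set.range_comp]
  have h : Set.range (Subtype.val ∘ toMuntzSpace q Λ) =
      (Submodule.span ℂ (Set.range fun n => monomialLp q lebesgue (Λ n)) : Set _) := by
    rw [← Finsupp.range_linearCombination]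
    rfl
  have hx : (x : Lp ℂ q lebesgue) ∈ closure
      (Submodule.span ℂ (Set.range fun n => monomialLp q lebesgue (Λ n)) : Set _) := x.2
  rw [← h] at hx
  exact hx

/-- `μ` is a Carleson measure for `M_Λ^q`: `‖f‖_{L^q(μ)} ≤ C ‖f‖_{L^q(m)}` for all Müntz
polynomials `f`. -/
def IsCarleson (q : ℝ≥0∞) [Fact (1 ≤ q)] (Λ : ℕ → ℝ≥0) (μ : Measure Unit01)
    [IsFiniteMeasure μ] : Prop :=
  ∃ C : ℝ, ∀ b : ℕ →₀ ℂ, ‖muntzPoly q Λ μ b‖ ≤ C * ‖muntzPoly q Λ lebesgue b‖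

/-- The embedding `i_μ^q : M_Λ^q → L^q(μ)`, `f ↦ f`: the unique bounded operator which sends every
Müntz polynomial to itself. It is meaningful when `μ` is a Carleson measure for `M_Λ^q`, see
`carlesonEmbedding_toMuntzSpace` and `eq_carlesonEmbedding`. -/
def carlesonEmbedding (q : ℝ≥0∞) [Fact (1 ≤ q)] (Λ : ℕ → ℝ≥0) (μ : Measure Unit01)
    [IsFiniteMeasure μ] : muntzSpace q Λ →L[ℂ] Lp ℂ q μ :=
  (muntzPoly q Λ μ).extendOfNorm (toMuntzSpace q Λ)

theorem carlesonEmbedding_toMuntzSpace {q : ℝ≥0∞} [Fact (1 ≤ q)] {Λ : ℕ → ℝ≥0}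
    {μ : Measure Unit01} [IsFiniteMeasure μ] (hμ : IsCarleson q Λ μ) (b : ℕ →₀ ℂ) :
    carlesonEmbedding q Λ μ (toMuntzSpace q Λ b) = muntzPoly q Λ μ b :=
  LinearMap.extendOfNorm_eq (denseRange_toMuntzSpace q Λ) hμ b

theorem eq_carlesonEmbedding {q : ℝ≥0∞} [Fact (1 ≤ q)] {Λ : ℕ → ℝ≥0}
    {μ : Measure Unit01} [IsFiniteMeasure μ] (hμ : IsCarleson q Λ μ)
    (S : muntzSpace q Λ →L[ℂ] Lp ℂ q μ)
    (hS : ∀ b, S (toMuntzSpace q Λ b) = muntzPoly q Λ μ b) : S = carlesonEmbedding q Λ μ := by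
  refine DFunLike.coe_injective
    ((denseRange_toMuntzSpace q Λ).equalizer S.continuous (carlesonEmbedding q Λ μ).continuous ?_)
  funext b
  exact (hS b).trans (carlesonEmbedding_toMuntzSpace hμ b).symm

/-- The essential norm of a bounded operator: its distance to the compact operators. -/
def essNorm {X Y : Type*} [NormedAddCommGroup X] [NormedSpace ℂ X] [NormedAddCommGroup Y]
    [NormedSpace ℂ Y] (S : X →L[ℂ] Y) : ℝ :=
  sInf {r : ℝ | ∃ K : X →L[ℂ] Y, IsCompactOperator K ∧ r = ‖S - K‖}

/-- `λ_n ∫_{[0,1)} t ^ λ_n dμ`. -/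
def moment (Λ : ℕ → ℝ≥0) (μ : Measure Unit01) (n : ℕ) : ℝ≥0∞ :=
  (Λ n : ℝ≥0∞) * ∫⁻ t, ENNReal.ofReal ((t : ℝ) ^ (Λ n : ℝ)) ∂μ

/-- `μ([1 - ε, 1)) / ε`. -/
def tailRatio (μ : Measure Unit01) (ε : ℝ) : ℝ≥0∞ :=
  μ {t | 1 - ε ≤ (t : ℝ)} / ENNReal.ofReal ε

/-- `μ` is vanishing sublinear: `μ([1 - ε, 1)) / ε → 0` as `ε → 0⁺`. -/
def IsVanishingSublinear (μ : Measure Unit01) : Prop :=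
  Tendsto (tailRatio μ) (𝓝[>] 0) (𝓝 0)

/-- `D_n(p) = (∫ λ_n^{1/p} t^{λ_n} (∑_k λ_k^{1/p} t^{λ_k})^{p-1} dμ)^{1/p}`, with values in
`[0, ∞]`. -/
def diagCoeff (Λ : ℕ → ℝ≥0) (μ : Measure Unit01) (p : ℝ) (n : ℕ) : ℝ≥0∞ :=
  (∫⁻ t, (Λ n : ℝ≥0∞) ^ (1 / p) * ENNReal.ofReal ((t : ℝ) ^ (Λ n : ℝ)) *
    (∑' k, (Λ k : ℝ≥0∞) ^ (1 / p) * ENNReal.ofReal ((t : ℝ) ^ (Λ k : ℝ))) ^ (p - 1) ∂μ) ^ (1 / p)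

/-- `A ≈ B` with constant `C`: both `A ≤ C B` and `B ≤ C A`. -/
def Comparable (C : ℝ≥0) (A B : ℝ≥0∞) : Prop :=
  A ≤ C * B ∧ B ≤ C * A

end Muntz

end

namespace Muntz

/-! Everything is compared with the upper tail density `L`, the limsup of `μ([1-ε,1))/ε`.

Tail density and integrals. Lacunarity gives `∑ λ_k^{1/p} t^{λ_k} ≲ (1-t)^{-1/p}`, so the integrand
of `D_n(p)^p` is at most a decreasing function of `1-t` whose Lebesgue integral does not depend on
`n` and which tends to `0` at each fixed distance from `1`; a layer-cake argument bounds its limsup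
by `L` (`exists_limsup_diagIntegral_le`). Conversely `t^{λ_n}` is bounded below on `[1-1/λ_n,1)`,
and bounded ratios fill the gaps between the scales `1/λ_n`, so `L` is at most a multiple of the
limsup of `λ_n ∫ t^{pλ_n} dμ` (`exists_limsup_tailRatio_le`), which is at most that of `D_n(p)^p`.
Taking `p = 1` gives the moments, `p = q` the `D_n(q)`.

Essential norm from above. Subtract the finite rank operator that keeps the first `N` terms.
Hölder's inequality bounds the `L^q(μ)` norm of the remainder by `∑ |b_n|^q λ_n⁻¹ D_n(q)^q` over `n
≥ N` (`lintegral_rpow_sum_le`), and the Gurariy–Macaev estimate `∑ |b_n|^q / λ_n ≲ ‖f‖^q`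
(`exists_sum_le_enorm_muntzPoly`) finishes. The latter is proved after `t = e^{-x}` with explicit
kernels: the Laplace transform of the `n`-th kernel at `κ_k` is `Q_n(κ_n/(κ_n+κ_k))`, where the
polynomial `Q_n` equals `1` at `1/2` and is tiny at the other nodes. The resulting matrix is a small
perturbation of the identity, inverted on a weighted `ℓ^p` by Schur's test
(`exists_lower_estimate`).

Essential norm from below. The monomials `λ_n^{1/q} t^{λ_n}` lie in the unit ball and their mass
moves to `1`, whereas the images under a compact operator accumulate at a fixed function, which has
little mass near `1`. Hence no compact operator approximates their images under the embedding
(`limsup_le_enorm_sub`). -/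

/-! ### Sums over lacunary sequences. -/

theorem sum_pow_le_of_injOn {ρ : ℝ} (h0 : 0 ≤ ρ) (h1 : ρ < 1) (S : Finset ℕ) (e : ℕ → ℕ)
    (he : Set.InjOn e S) : ∑ n ∈ S, ρ ^ e n ≤ (1 - ρ)⁻¹ := by
  rw [← tsum_geometric_of_lt_one h0 h1, ← Finset.sum_image (f := fun m => ρ ^ m) he]
  exact (summable_geometric_of_lt_one h0 h1).sum_le_tsum _ fun _ _ => by positivity

theorem pow_mul_le_of_lacunary {r : ℝ} {κ : ℕ → ℝ} (hr : 0 ≤ r)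
    (h : ∀ n, r * κ n ≤ κ (n + 1)) (n k : ℕ) : r ^ k * κ n ≤ κ (n + k) := by
  induction k with
  | zero => simp
  | succ k ih =>
    calc r ^ (k + 1) * κ n = r * (r ^ k * κ n) := by ring
      _ ≤ r * κ (n + k) := by gcongr
      _ ≤ κ (n + (k + 1)) := h _

theorem strictMono_of_lacunary {r : ℝ} {κ : ℕ → ℝ} (hr : 1 < r) (hκ : ∀ n, 0 < κ n)
    (h : ∀ n, r * κ n ≤ κ (n + 1)) : StrictMono κ :=
  strictMono_nat_of_lt_succ fun n => by nlinarith [h n, hκ n]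

theorem tendsto_atTop_of_lacunary {r : ℝ} {κ : ℕ → ℝ} (hr : 1 < r) (hκ : ∀ n, 0 < κ n)
    (h : ∀ n, r * κ n ≤ κ (n + 1)) : Tendsto κ atTop atTop := by
  refine tendsto_atTop_mono (fun n => ?_)
    ((tendsto_pow_atTop_atTop_of_one_lt hr).atTop_mul_const (hκ 0))
  simpa using pow_mul_le_of_lacunary (by linarith) h 0 n

/-- The terms decay geometrically on both sides of the index where `κ n * x` crosses `1`; each side
is compared with a geometric series counted from its index nearest to the crossing. -/
theorem sum_min_le_of_lacunary {r : ℝ} {κ : ℕ → ℝ} (hr : 1 < r) (hκ : ∀ n, 0 < κ n)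
    (h : ∀ n, r * κ n ≤ κ (n + 1)) (S : Finset ℕ) {x : ℝ} (hx : 0 < x) :
    ∑ n ∈ S, min (κ n * x) (κ n * x)⁻¹ ≤ 2 * (1 - r⁻¹)⁻¹ := by
  have hr0 : 0 < r := by linarith
  have hρ0 : 0 ≤ r⁻¹ := by positivity
  have hρ1 : r⁻¹ < 1 := inv_lt_one_of_one_lt₀ hr
  have key : ∀ n k, n ≤ k → κ n * x ≤ r⁻¹ ^ (k - n) * (κ k * x) := by
    intro n k hnk
    have := pow_mul_le_of_lacunary hr0.le h n (k - n)
    rw [Nat.add_sub_cancel' hnk] at this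
    rw [inv_pow, ← div_eq_inv_mul, le_div_iff₀ (by positivity)]
    nlinarith
  rw [← Finset.sum_filter_add_sum_filter_not S fun n => κ n * x ≤ 1, two_mul]
  refine add_le_add ?_ ?_
  · obtain ⟨M, hM⟩ | hemp := (S.filter fun n => κ n * x ≤ 1).eq_empty_or_nonempty.symm.imp
      (fun hne => Finset.exists_max_image _ id hne) id
    · refine le_trans (Finset.sum_le_sum fun n hn => ?_)
        (sum_pow_le_of_injOn hρ0 hρ1 _ (fun n => M - n) ?_)
      · refine (min_le_left _ _).trans ((key n M (hM.2 n hn)).trans ?_)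
        exact mul_le_of_le_one_right (by positivity) (Finset.mem_filter.1 hM.1).2
      · intro a ha b hb hab
        have := hM.2 a ha; have := hM.2 b hb
        simp only [id] at *; omega
    · rw [hemp, Finset.sum_empty]; exact inv_nonneg.2 (by linarith)
  · obtain ⟨M, hM⟩ | hemp := (S.filter fun n => ¬ κ n * x ≤ 1).eq_empty_or_nonempty.symm.imp
      (fun hne => Finset.exists_min_image _ id hne) id
    · refine le_trans (Finset.sum_le_sum fun n hn => ?_)
        (sum_pow_le_of_injOn hρ0 hρ1 _ (fun n => n - M) ?_)
      · refine (min_le_right _ _).trans ?_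
        have h1 := key M n (hM.2 n hn)
        have h2 : 1 < κ M * x := not_le.1 (Finset.mem_filter.1 hM.1).2
        rw [inv_le_iff_one_le_mul₀ (mul_pos (hκ n) hx)]
        linarith
      · intro a ha b hb hab
        have := hM.2 a ha; have := hM.2 b hb
        simp only [id] at *; omega
    · rw [hemp, Finset.sum_empty]; exact inv_nonneg.2 (by linarith)

/-! ### Interpolation polynomials with controlled coefficients. -/

open Polynomial in
theorem abs_coeff_mul_X_sub_C_le {P : ℝ[X]} {B a : ℝ} (hP : ∀ i, |P.coeff i| ≤ B)
    (ha0 : 0 ≤ a) (ha1 : a ≤ 1) (i : ℕ) : |(P * (X - C a)).coeff i| ≤ B * 2 := by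
  have hB : 0 ≤ B := (abs_nonneg _).trans (hP 0)
  cases i with
  | zero =>
    rw [mul_coeff_zero, abs_mul]
    simp only [coeff_sub, coeff_X_zero, coeff_C_zero, zero_sub, abs_neg, abs_of_nonneg ha0]
    nlinarith [hP 0, abs_nonneg (P.coeff 0)]
  | succ i =>
    rw [coeff_mul_X_sub_C]
    refine (abs_sub _ _).trans ?_
    rw [abs_mul, abs_of_nonneg ha0]
    nlinarith [hP i, hP (i + 1), abs_nonneg (P.coeff (i + 1))]

open Polynomial in
theorem abs_coeff_mul_prod_le {ι : Type*} {P : ℝ[X]} {B : ℝ} (hP : ∀ i, |P.coeff i| ≤ B)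
    (T : Finset ι) {w : ι → ℝ} (hw : ∀ k ∈ T, 0 ≤ w k ∧ w k ≤ 1) (i : ℕ) :
    |(P * ∏ k ∈ T, (X - C (w k))).coeff i| ≤ B * 2 ^ T.card := by
  classical
  induction T using Finset.induction_on generalizing i with
  | empty => simpa using hP i
  | insert a T ha ih =>
    rw [Finset.prod_insert ha, Finset.card_insert_of_notMem ha, mul_comm (X - C (w a)),
      ← mul_assoc, pow_succ, ← mul_assoc]
    have h := hw a (Finset.mem_insert_self _ _)
    exact abs_coeff_mul_X_sub_C_le (ih fun k hk => hw k (Finset.mem_insert_of_mem hk)) h.1 h.2 i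

open Polynomial in
/-- A polynomial which takes the value `1` at `1 / 2`, vanishes at prescribed points of `[0, 1]`
and is small near the ends of `[0, 1]`, with control of the coefficients. -/
theorem exists_interpolation_polynomial (N : ℕ) (T : Finset ℕ) (w : ℕ → ℝ) {δ : ℝ} (hδ : 0 < δ)
    (hw : ∀ k ∈ T, 0 ≤ w k ∧ w k ≤ 1) (hw' : ∀ k ∈ T, δ ≤ |1 / 2 - w k|) :
    ∃ Q : ℝ[X], Q.natDegree ≤ 2 * N + T.card ∧ (∀ i < N, Q.coeff i = 0) ∧
      (∀ i, |Q.coeff i| ≤ 4 ^ N * δ⁻¹ ^ T.card * (2 ^ N * 2 ^ T.card)) ∧ Q.eval (1 / 2) = 1 ∧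
      (∀ k ∈ T, Q.eval (w k) = 0) ∧
      ∀ x, 0 ≤ x → x ≤ 1 → |Q.eval x| ≤ (4 * (x * (1 - x))) ^ N * δ⁻¹ ^ T.card := by
  have hne : ∀ k ∈ T, 1 / 2 - w k ≠ 0 := fun k hk => abs_pos.1 (hδ.trans_le (hw' k hk))
  have hprod : |∏ k ∈ T, (1 / 2 - w k)|⁻¹ ≤ δ⁻¹ ^ T.card := by
    rw [inv_pow, Finset.abs_prod, ← Finset.prod_const]
    exact inv_anti₀ (Finset.prod_pos fun _ _ => hδ) (Finset.prod_le_prod (fun _ _ => hδ.le) hw')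
  have hprod0 : ∏ k ∈ T, (1 / 2 - w k) ≠ 0 := Finset.prod_ne_zero_iff.2 hne
  -- Normalisation at `1/2`, where `X (X - 1)` takes the value `-1/4`.
  set c : ℝ := (-4) ^ N * (∏ k ∈ T, (1 / 2 - w k))⁻¹ with hc
  have hcabs : |c| ≤ 4 ^ N * δ⁻¹ ^ T.card := by
    rw [hc, abs_mul, abs_pow, abs_inv, abs_neg, abs_of_pos (by norm_num : (0 : ℝ) < 4)]
    gcongr
  refine ⟨C c * (X ^ N * ((∏ _i ∈ Finset.range N, (X - C 1)) * ∏ k ∈ T, (X - C (w k)))),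
    ?_, ?_, ?_, ?_, ?_, ?_⟩
  · refine (natDegree_C_mul_le _ _).trans (natDegree_mul_le.trans ?_)
    have h1 : (∏ _i ∈ Finset.range N, (X - C (1 : ℝ))).natDegree ≤ N := by
      refine (natDegree_prod_le _ _).trans ?_
      simp_rw [natDegree_X_sub_C]
      simp
    have h2 : (∏ k ∈ T, (X - C (w k))).natDegree ≤ T.card := by
      refine (natDegree_prod_le _ _).trans ?_
      simp
    have h3 := natDegree_mul_le (p := ∏ _i ∈ Finset.range N, (X - C (1 : ℝ)))
      (q := ∏ k ∈ T, (X - C (w k)))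
    rw [natDegree_X_pow]
    omega
  · intro i hi
    rw [coeff_C_mul, coeff_X_pow_mul', if_neg (by omega), mul_zero]
  · intro i
    rw [coeff_C_mul, abs_mul, ← mul_assoc]
    have h0 : ∀ i, |((X : ℝ[X]) ^ N).coeff i| ≤ 1 := fun i => by
      rw [coeff_X_pow]; split_ifs <;> simp
    have h1 : ∀ i, |((X : ℝ[X]) ^ N * ∏ _i ∈ Finset.range N, (X - C (1 : ℝ))).coeff i|
        ≤ 2 ^ N := fun i => by
      simpa using abs_coeff_mul_prod_le h0 (Finset.range N) (w := fun _ => 1) (by simp) i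
    gcongr
    exact abs_coeff_mul_prod_le h1 T hw i
  · have : (-4 : ℝ) ^ N * ((1 / 2) ^ N * (1 / 2 - 1) ^ N) = 1 := by
      rw [← mul_pow, ← mul_pow]; norm_num
    simp only [eval_mul, eval_C, eval_pow, eval_X, eval_prod, eval_sub, Finset.prod_const,
      Finset.card_range]
    rw [hc]
    calc _ = ((-4 : ℝ) ^ N * ((1 / 2) ^ N * (1 / 2 - 1) ^ N)) *
          ((∏ k ∈ T, (1 / 2 - w k))⁻¹ * ∏ k ∈ T, (1 / 2 - w k)) := by ring
      _ = 1 := by rw [this, inv_mul_cancel₀ hprod0, one_mul]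
  · intro k hk
    simp only [eval_mul, eval_prod]
    rw [Finset.prod_eq_zero (i := k) hk (by simp)]
    simp
  · intro x hx0 hx1
    simp only [eval_mul, eval_C, eval_pow, eval_X, eval_prod, eval_sub, Finset.prod_const,
      Finset.card_range]
    clear_value c
    have h1 : |∏ k ∈ T, (x - w k)| ≤ 1 := by
      rw [Finset.abs_prod]
      refine Finset.prod_le_one (fun _ _ => abs_nonneg _) fun k hk => ?_
      have := hw k hk
      rw [abs_le]; constructor <;> linarith
    have h2 : |x - 1| = 1 - x := by rw [abs_sub_comm, abs_of_nonneg (by linarith)]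
    rw [abs_mul c, abs_mul (x ^ N), abs_mul ((x - 1) ^ N), abs_pow, abs_pow, h2, abs_of_nonneg hx0]
    have h3 : 0 ≤ 1 - x := by linarith
    calc _ ≤ (4 ^ N * δ⁻¹ ^ T.card) * (x ^ N * ((1 - x) ^ N * 1)) := by gcongr
      _ = _ := by rw [mul_pow, mul_pow]; ring

/-! ### Kernels with prescribed Laplace transform. -/

theorem integrableOn_pow_mul_exp_neg (j : ℕ) {a : ℝ} (ha : 0 < a) :
    IntegrableOn (fun x : ℝ => x ^ j * Real.exp (-(a * x))) (Set.Ioi 0) := by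
  have := integrableOn_rpow_mul_exp_neg_mul_rpow (p := 1) (s := j) (b := a)
    (by have : (0 : ℝ) ≤ j := j.cast_nonneg
        linarith) one_pos ha
  simpa [neg_mul] using this

theorem integral_pow_mul_exp_neg (j : ℕ) {a : ℝ} (ha : 0 < a) :
    ∫ x : ℝ in Set.Ioi 0, x ^ j * Real.exp (-(a * x)) = j.factorial / a ^ (j + 1) := by
  have := Real.integral_rpow_mul_exp_neg_mul_Ioi (a := j + 1) (r := a) (by positivity) ha
  rw [Real.Gamma_nat_eq_factorial] at this
  have h2 : (1 / a) ^ ((j : ℝ) + 1) = (1 / a) ^ (j + 1) := by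
    rw [← Real.rpow_natCast]; push_cast; rfl
  simp only [add_sub_cancel_right, Real.rpow_natCast, h2] at this
  rw [this, one_div, inv_pow]
  field_simp

/-- The function on `(0, ∞)` whose Laplace transform at `s` is `Q (κ / (κ + s))`, when
`Q 0 = 0`. -/
noncomputable def laplaceKernel (Q : Polynomial ℝ) (κ x : ℝ) : ℝ :=
  ∑ j ∈ Finset.range Q.natDegree,
    Q.coeff (j + 1) * κ ^ (j + 1) / j.factorial * (x ^ j * Real.exp (-(κ * x)))

theorem continuous_laplaceKernel (Q : Polynomial ℝ) (κ : ℝ) : Continuous (laplaceKernel Q κ) := by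
  unfold laplaceKernel; fun_prop

theorem exp_mul_laplaceKernel (Q : Polynomial ℝ) (κ s x : ℝ) :
    Real.exp (-(s * x)) * laplaceKernel Q κ x = ∑ j ∈ Finset.range Q.natDegree,
      Q.coeff (j + 1) * κ ^ (j + 1) / j.factorial * (x ^ j * Real.exp (-((κ + s) * x))) := by
  rw [laplaceKernel, Finset.mul_sum]
  refine Finset.sum_congr rfl fun j _ => ?_
  rw [add_mul, neg_add, Real.exp_add]; ring

theorem integrableOn_exp_mul_laplaceKernel (Q : Polynomial ℝ) {κ s : ℝ} (h : 0 < κ + s) :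
    IntegrableOn (fun x => Real.exp (-(s * x)) * laplaceKernel Q κ x) (Set.Ioi 0) := by
  simp_rw [exp_mul_laplaceKernel]
  exact integrable_finsetSum _ fun j _ => (integrableOn_pow_mul_exp_neg j h).const_mul _

theorem integral_exp_mul_laplaceKernel {Q : Polynomial ℝ} (hQ : Q.coeff 0 = 0) {κ s : ℝ}
    (h : 0 < κ + s) :
    ∫ x in Set.Ioi 0, Real.exp (-(s * x)) * laplaceKernel Q κ x = Q.eval (κ / (κ + s)) := by
  simp_rw [exp_mul_laplaceKernel]
  rw [integral_finsetSum _ fun j _ => (integrableOn_pow_mul_exp_neg j h).const_mul _,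
    Polynomial.eval_eq_sum_range, Finset.sum_range_succ', hQ, zero_mul, add_zero]
  refine Finset.sum_congr rfl fun j _ => ?_
  rw [integral_const_mul, integral_pow_mul_exp_neg j h, div_pow]
  have := j.factorial_ne_zero
  field_simp

/-- Both bounds come from `y^i e^{-y} ≤ i!`, with `i = j - 1` and `i = j + 1`. For `j = 0` there is
no decay at `y = 0`. -/
theorem pow_mul_exp_neg_le {j : ℕ} (hj : 1 ≤ j) {y : ℝ} (hy : 0 < y) :
    y ^ j / j.factorial * Real.exp (-y) ≤ (j + 1) * min y y⁻¹ := by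
  have hf : ∀ i : ℕ, y ^ i * Real.exp (-y) ≤ i.factorial := fun i => by
    have := Real.pow_div_factorial_le_exp y hy.le i
    rw [div_le_iff₀ (by positivity)] at this
    rw [Real.exp_neg, ← div_eq_mul_inv, div_le_iff₀ (Real.exp_pos _)]
    linarith
  obtain ⟨i, rfl⟩ : ∃ i, j = i + 1 := ⟨j - 1, by omega⟩
  have hpos : (0 : ℝ) < (i + 1).factorial := by positivity
  rw [div_mul_eq_mul_div, div_le_iff₀ hpos]
  rcases min_cases y y⁻¹ with ⟨h, -⟩ | ⟨h, -⟩ <;> rw [h]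
  · have h1 : (i.factorial : ℝ) ≤ (i + 1).factorial := by
      exact_mod_cast Nat.factorial_le (Nat.le_succ i)
    calc y ^ (i + 1) * Real.exp (-y) = y * (y ^ i * Real.exp (-y)) := by ring
      _ ≤ y * (i + 1).factorial := by gcongr; exact (hf i).trans h1
      _ ≤ _ := by
        rw [mul_assoc]
        refine le_mul_of_one_le_left (by positivity) ?_
        push_cast; linarith [(Nat.cast_nonneg i : (0 : ℝ) ≤ i)]
  · have h1 := hf (i + 1 + 1)
    rw [Nat.factorial_succ] at h1
    push_cast at h1 ⊢
    calc y ^ (i + 1) * Real.exp (-y) = y⁻¹ * (y ^ (i + 1 + 1) * Real.exp (-y)) := by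
          rw [pow_succ y (i + 1)]; field_simp
      _ ≤ y⁻¹ * (((i : ℝ) + 1 + 1) * (i + 1).factorial) := by gcongr
      _ = _ := by ring

/-- Vanishing of the linear coefficient removes the term `e^{-κx}`, the only one without decay at
`0`. The two-sided decay in `κ x` makes the kernels summable over a lacunary sequence of `κ`. -/
theorem abs_laplaceKernel_le {Q : Polynomial ℝ} (hQ : Q.coeff 1 = 0) {B : ℝ}
    (hB : ∀ i, |Q.coeff i| ≤ B) {d : ℕ} (hd : Q.natDegree ≤ d) {κ x : ℝ} (hκ : 0 < κ)
    (hx : 0 < x) : |laplaceKernel Q κ x| ≤ B * d ^ 2 * (κ * min (κ * x) (κ * x)⁻¹) := by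
  have hB0 : 0 ≤ B := (abs_nonneg _).trans (hB 0)
  have hm : 0 ≤ min (κ * x) (κ * x)⁻¹ := le_min (by positivity) (by positivity)
  calc |laplaceKernel Q κ x| ≤ ∑ j ∈ Finset.range Q.natDegree,
        B * d * (κ * min (κ * x) (κ * x)⁻¹) := by
        refine (Finset.abs_sum_le_sum_abs _ _).trans (Finset.sum_le_sum fun j hj => ?_)
        rcases Nat.eq_zero_or_pos j with rfl | hj1
        · simp only [zero_add, hQ]
          simp only [zero_mul, zero_div, abs_zero]
          positivity
        · have h1 := pow_mul_exp_neg_le hj1 (mul_pos hκ hx)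
          have h2 : ((j : ℝ) + 1) ≤ d := by
            exact_mod_cast (Finset.mem_range.1 hj).trans_le hd
          have h3 : 0 ≤ (κ * x) ^ j / j.factorial * Real.exp (-(κ * x)) := by positivity
          calc |Q.coeff (j + 1) * κ ^ (j + 1) / j.factorial * (x ^ j * Real.exp (-(κ * x)))|
              = |Q.coeff (j + 1) * (κ * ((κ * x) ^ j / j.factorial * Real.exp (-(κ * x))))| := by
                rw [mul_pow]; congr 1; ring
            _ = |Q.coeff (j + 1)| * (κ * ((κ * x) ^ j / j.factorial * Real.exp (-(κ * x)))) := by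
                rw [abs_mul, abs_of_nonneg (by positivity : 0 ≤ κ * _)]
            _ ≤ B * (κ * (d * min (κ * x) (κ * x)⁻¹)) := by
                have h4 := h1.trans (mul_le_mul_of_nonneg_right h2 hm)
                exact mul_le_mul (hB _) (mul_le_mul_of_nonneg_left h4 hκ.le) (by positivity) hB0
            _ = _ := by ring
    _ = Q.natDegree * (B * d * (κ * min (κ * x) (κ * x)⁻¹)) := by simp
    _ ≤ d * (B * d * (κ * min (κ * x) (κ * x)⁻¹)) := by gcongr
    _ = _ := by ring

/-- By scaling, each normalised term `κ^{j+1} x^j e^{-κx} / j!` has integral `1`, so the bound is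
uniform in `κ`. -/
theorem lintegral_enorm_laplaceKernel_le {Q : Polynomial ℝ} {B : ℝ}
    (hB : ∀ i, |Q.coeff i| ≤ B) {d : ℕ} (hd : Q.natDegree ≤ d) {κ : ℝ} (hκ : 0 < κ) :
    ∫⁻ x in Set.Ioi 0, ‖laplaceKernel Q κ x‖ₑ ≤ ENNReal.ofReal (B * d) := by
  have hB0 : 0 ≤ B := (abs_nonneg _).trans (hB 0)
  have hint : IntegrableOn (fun x : ℝ => ∑ j ∈ Finset.range Q.natDegree,
      B * κ ^ (j + 1) / j.factorial * (x ^ j * Real.exp (-(κ * x)))) (Set.Ioi 0) :=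
    integrable_finsetSum _ fun j _ => (integrableOn_pow_mul_exp_neg j hκ).const_mul _
  calc ∫⁻ x in Set.Ioi 0, ‖laplaceKernel Q κ x‖ₑ
      ≤ ∫⁻ x in Set.Ioi 0, ENNReal.ofReal (∑ j ∈ Finset.range Q.natDegree,
          B * κ ^ (j + 1) / j.factorial * (x ^ j * Real.exp (-(κ * x)))) := by
        refine setLIntegral_mono' measurableSet_Ioi fun x hx => ?_
        have hx : 0 < x := hx
        rw [← ofReal_norm]
        refine ENNReal.ofReal_le_ofReal
          ((Finset.abs_sum_le_sum_abs _ _).trans (Finset.sum_le_sum fun j _ => ?_))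
        rw [abs_mul, abs_div, abs_mul, abs_of_pos (by positivity : 0 < κ ^ (j + 1)),
          abs_of_nonneg (by positivity : (0 : ℝ) ≤ j.factorial),
          abs_of_nonneg (by positivity : 0 ≤ x ^ j * Real.exp (-(κ * x)))]
        gcongr
        exact hB _
    _ = ENNReal.ofReal (∑ j ∈ Finset.range Q.natDegree, B) := by
        rw [← ofReal_integral_eq_lintegral_ofReal hint]
        · rw [integral_finsetSum _ fun j _ => (integrableOn_pow_mul_exp_neg j hκ).const_mul _]
          congr 1
          refine Finset.sum_congr rfl fun j _ => ?_
          rw [integral_const_mul, integral_pow_mul_exp_neg j hκ]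
          have := j.factorial_ne_zero
          field_simp
        · refine (ae_restrict_iff' measurableSet_Ioi).2 (Eventually.of_forall fun x hx => ?_)
          have hx : 0 < x := hx
          exact Finset.sum_nonneg fun j _ => by positivity
    _ ≤ _ := by
        refine ENNReal.ofReal_le_ofReal ?_
        simp only [Finset.sum_const, Finset.card_range, nsmul_eq_mul]
        rw [mul_comm]; gcongr

/-! ### Weighted Hölder inequalities and Schur's test. -/

theorem rpow_sum_mul_le {ι : Type*} (S : Finset ι) {p : ℝ} (hp : 1 ≤ p) (w f : ι → ℝ≥0∞) :
    (∑ i ∈ S, w i * f i) ^ p ≤ (∑ i ∈ S, w i) ^ (p - 1) * ∑ i ∈ S, w i * f i ^ p := by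
  have hp0 : 0 < p := by linarith
  have h := ENNReal.rpow_le_rpow (ENNReal.inner_le_weight_mul_Lp_of_nonneg S hp w f) hp0.le
  rwa [ENNReal.mul_rpow_of_nonneg _ _ hp0.le, ← ENNReal.rpow_mul, ← ENNReal.rpow_mul,
    inv_mul_cancel₀ hp0.ne', ENNReal.rpow_one, sub_mul, one_mul, inv_mul_cancel₀ hp0.ne'] at h

theorem rpow_lintegral_mul_le {α : Type*} [MeasurableSpace α] (ν : Measure α) {p : ℝ} (hp : 1 ≤ p)
    {w f : α → ℝ≥0∞} (hw : Measurable w) (hf : Measurable f) :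
    (∫⁻ x, w x * f x ∂ν) ^ p ≤ (∫⁻ x, w x ∂ν) ^ (p - 1) * ∫⁻ x, w x * f x ^ p ∂ν := by
  have hp0 : 0 < p := by linarith
  -- The inequality compares the `L^1` and `L^p` norms of `f` for the measure with density `w`.
  have h := eLpNorm'_le_eLpNorm'_mul_rpow_measure_univ (μ := ν.withDensity w) one_pos hp
    hf.aestronglyMeasurable
  have h := ENNReal.rpow_le_rpow h hp0.le
  simp only [eLpNorm', enorm_eq_self, ENNReal.rpow_one, div_one] at h
  rw [ENNReal.mul_rpow_of_nonneg _ _ hp0.le, ← ENNReal.rpow_mul, ← ENNReal.rpow_mul,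
    one_div_mul_cancel hp0.ne', ENNReal.rpow_one, sub_mul, one_mul, one_div_mul_cancel hp0.ne',
    lintegral_withDensity_eq_lintegral_mul _ hw hf,
    lintegral_withDensity_eq_lintegral_mul _ hw (hf.pow_const p),
    withDensity_apply _ MeasurableSet.univ, setLIntegral_univ] at h
  exact h.trans_eq (mul_comm _ _)

/-- Schur's test, used to invert a small perturbation of the identity on `ℓ^p`. -/
theorem sum_rpow_le_of_le_add_sum {ι : Type*} (S : Finset ι) {p : ℝ} (hp : 1 ≤ p)
    {b u : ι → ℝ≥0∞} {M : ι → ι → ℝ≥0∞} (hb : ∀ i ∈ S, b i ≠ ∞)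
    (h : ∀ i ∈ S, b i ≤ u i + ∑ k ∈ S, M i k * b k) (hrow : ∀ i ∈ S, ∑ k ∈ S, M i k ≤ 2⁻¹)
    (hcol : ∀ k ∈ S, ∑ i ∈ S, M i k ≤ 2⁻¹) :
    ∑ i ∈ S, b i ^ p ≤ 2 ^ p * ∑ i ∈ S, u i ^ p := by
  have hp0 : 0 < p := by linarith
  have h2 : (2 : ℝ≥0∞) ^ p = 2 * 2 ^ (p - 1) := by
    rw [ENNReal.rpow_sub _ _ (by simp) (by simp), ENNReal.rpow_one, ENNReal.mul_div_cancel] <;> simp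
  set s := ∑ i ∈ S, b i ^ p with hs
  have hs_top : s ≠ ∞ := ENNReal.sum_ne_top.2 fun i hi =>
    ENNReal.rpow_ne_top_of_nonneg hp0.le (hb i hi)
  have hM : ∑ i ∈ S, (∑ k ∈ S, M i k * b k) ^ p ≤ (2⁻¹ : ℝ≥0∞) ^ p * s := by
    calc ∑ i ∈ S, (∑ k ∈ S, M i k * b k) ^ p
        ≤ ∑ i ∈ S, (2⁻¹ : ℝ≥0∞) ^ (p - 1) * ∑ k ∈ S, M i k * b k ^ p := by
          refine Finset.sum_le_sum fun i hi => (rpow_sum_mul_le S hp _ _).trans ?_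
          gcongr
          exact hrow i hi
      _ = (2⁻¹ : ℝ≥0∞) ^ (p - 1) * ∑ k ∈ S, (∑ i ∈ S, M i k) * b k ^ p := by
          rw [← Finset.mul_sum, Finset.sum_comm]; simp_rw [Finset.sum_mul]
      _ ≤ (2⁻¹ : ℝ≥0∞) ^ (p - 1) * ∑ k ∈ S, 2⁻¹ * b k ^ p := by
          gcongr with k hk; exact hcol k hk
      _ = (2⁻¹ : ℝ≥0∞) ^ p * s := by
          rw [← Finset.mul_sum, ← mul_assoc]
          congr 1
          conv_lhs => rw [← ENNReal.rpow_one (2⁻¹ : ℝ≥0∞), ← ENNReal.rpow_mul, one_mul]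
          rw [← ENNReal.rpow_add _ _ (by simp) (by simp), sub_add_cancel]
  have hmain : s ≤ 2 ^ (p - 1) * ∑ i ∈ S, u i ^ p + 2⁻¹ * s := by
    calc s ≤ ∑ i ∈ S, 2 ^ (p - 1) * (u i ^ p + (∑ k ∈ S, M i k * b k) ^ p) := by
          refine Finset.sum_le_sum fun i hi => ?_
          exact (ENNReal.rpow_le_rpow (h i hi) hp0.le).trans
            (ENNReal.rpow_add_le_mul_rpow_add_rpow _ _ hp)
      _ = 2 ^ (p - 1) * ∑ i ∈ S, u i ^ p + 2 ^ (p - 1) * ∑ i ∈ S, (∑ k ∈ S, M i k * b k) ^ p := by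
          rw [← Finset.mul_sum, Finset.sum_add_distrib, mul_add]
      _ ≤ 2 ^ (p - 1) * ∑ i ∈ S, u i ^ p + 2 ^ (p - 1) * ((2⁻¹ : ℝ≥0∞) ^ p * s) := by gcongr
      _ = _ := by
          rw [← mul_assoc, ENNReal.inv_rpow, h2, ENNReal.mul_inv (by simp) (by simp),
            mul_left_comm, ENNReal.mul_inv_cancel, mul_one]
          · exact (ENNReal.rpow_pos (by simp) (by simp)).ne'
          · exact ENNReal.rpow_ne_top_of_nonneg (by linarith) (by simp)
  have hhalf : s = 2⁻¹ * s + 2⁻¹ * s := by rw [← add_mul, ENNReal.inv_two_add_inv_two, one_mul]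
  -- Half of `s` is absorbed on the left, which is legitimate because `s` is finite.
  have h3 : 2⁻¹ * s ≤ 2 ^ (p - 1) * ∑ i ∈ S, u i ^ p := by
    conv_lhs at hmain => rw [hhalf]
    exact (ENNReal.add_le_add_iff_right (ENNReal.mul_ne_top (by simp) hs_top)).1 hmain
  calc s = 2 * (2⁻¹ * s) := by rw [← mul_assoc, ENNReal.mul_inv_cancel (by simp) (by simp), one_mul]
    _ ≤ 2 * (2 ^ (p - 1) * ∑ i ∈ S, u i ^ p) := by gcongr
    _ = _ := by rw [h2, mul_assoc]

/-! ### Almost biorthogonal polynomials. -/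

/-- The smaller of the two ratios of `a` and `b`. -/
noncomputable def minRatio (a b : ℝ) : ℝ := min (a / b) (b / a)

theorem minRatio_comm (a b : ℝ) : minRatio a b = minRatio b a := min_comm _ _

theorem minRatio_pos {a b : ℝ} (ha : 0 < a) (hb : 0 < b) : 0 < minRatio a b :=
  lt_min (div_pos ha hb) (div_pos hb ha)

theorem minRatio_le_one {a b : ℝ} (ha : 0 < a) (hb : 0 < b) : minRatio a b ≤ 1 := by
  rcases le_total a b with h | h
  · exact (min_le_left _ _).trans ((div_le_one hb).2 h)
  · exact (min_le_right _ _).trans ((div_le_one ha).2 h)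

theorem sum_minRatio_le_of_lacunary {r : ℝ} {κ : ℕ → ℝ} (hr : 1 < r) (hκ : ∀ n, 0 < κ n)
    (h : ∀ n, r * κ n ≤ κ (n + 1)) (S : Finset ℕ) {x : ℝ} (hx : 0 < x) :
    ∑ n ∈ S, minRatio (κ n) x ≤ 2 * (1 - r⁻¹)⁻¹ := by
  have := sum_min_le_of_lacunary hr hκ h S (inv_pos.2 hx)
  simpa [minRatio, div_eq_mul_inv] using this

theorem minRatio_le_pow_of_lacunary {r : ℝ} {κ : ℕ → ℝ} (hr : 1 < r) (hκ : ∀ n, 0 < κ n)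
    (h : ∀ n, r * κ n ≤ κ (n + 1)) {n k N : ℕ} (hnk : n + N ≤ k) :
    minRatio (κ n) (κ k) ≤ r⁻¹ ^ N := by
  refine (min_le_left _ _).trans ?_
  have h1 := pow_mul_le_of_lacunary (by linarith) h n N
  have h2 := (strictMono_of_lacunary hr hκ h).monotone hnk
  have : 0 < r := by linarith
  rw [inv_pow, div_le_iff₀ (hκ k), ← div_eq_inv_mul, le_div_iff₀ (by positivity)]
  linarith

theorem mul_one_sub_ratio_le_minRatio {a b : ℝ} (ha : 0 < a) (hb : 0 < b) :
    a / (a + b) * (1 - a / (a + b)) ≤ minRatio a b := by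
  have h1 : 1 - a / (a + b) = b / (a + b) := by field_simp; ring
  rw [h1, div_mul_div_comm]
  refine le_min ?_ ?_ <;> rw [div_le_div_iff₀ (by positivity) (by positivity)] <;>
    nlinarith [mul_pos ha hb, mul_pos (mul_pos ha hb) ha, mul_pos (mul_pos ha hb) hb,
      pow_pos ha 3, pow_pos hb 3]

/-- Lacunarity keeps the off-diagonal nodes away from the diagonal node `1/2`, so dividing by the
differences costs a bounded factor per node. -/
theorem le_abs_half_sub_ratio {r a b : ℝ} (hr : 1 < r) (ha : 0 < a) (hb : 0 < b)
    (h : r * a ≤ b ∨ r * b ≤ a) : (r - 1) / (2 * (r + 1)) ≤ |1 / 2 - a / (a + b)| := by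
  have h1 : 1 / 2 - a / (a + b) = (b - a) / (2 * (a + b)) := by field_simp; ring
  rw [h1, abs_div, abs_of_pos (by positivity : 0 < 2 * (a + b)),
    div_le_div_iff₀ (by linarith) (by positivity)]
  rcases h with h | h
  · rw [abs_of_nonneg (by nlinarith)]; nlinarith
  · rw [abs_of_nonpos (by nlinarith)]; nlinarith

/-- For a lacunary sequence there are polynomials `Q n` with uniform bounds such that the matrix
`Q n (κ n / (κ n + κ k))` is close to the identity. -/
theorem exists_almost_biorthogonal {r : ℝ} {κ : ℕ → ℝ} (hr : 1 < r) (hκ : ∀ n, 0 < κ n)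
    (h : ∀ n, r * κ n ≤ κ (n + 1)) {η : ℝ} (hη : 0 < η) :
    ∃ (B : ℝ) (d : ℕ), ∀ n, ∃ Q : Polynomial ℝ, Q.natDegree ≤ d ∧ Q.coeff 0 = 0 ∧ Q.coeff 1 = 0 ∧
      (∀ i, |Q.coeff i| ≤ B) ∧ Q.eval (1 / 2) = 1 ∧
      ∀ k, k ≠ n → |Q.eval (κ n / (κ n + κ k))| ≤ η * minRatio (κ n) (κ k) ^ 2 := by
  have hr0 : 0 < r := by linarith
  set δ : ℝ := (r - 1) / (2 * (r + 1)) with hδ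
  have hδ0 : 0 < δ := div_pos (by linarith) (by linarith)
  have hδ1 : 1 ≤ δ⁻¹ := by
    rw [one_le_inv₀ hδ0, hδ, div_le_one (by linarith)]; linarith
  obtain ⟨M, hM⟩ := exists_pow_lt_of_lt_one
    (show 0 < min η 1 * (4 * δ⁻¹ ^ 2)⁻¹ from mul_pos (lt_min hη one_pos) (by positivity))
    (inv_lt_one_of_one_lt₀ hr)
  rw [← div_eq_mul_inv, lt_div_iff₀ (by positivity)] at hM
  -- Indices within `N` of `n` are killed by zeros of `Q`. Further away, `(4m)^N δ^{-2N}` with `m ≤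
  -- r^{-N}` is split as `m^M * m^2`: the factor `m^M` beats the constants by the choice of `M`, and
  -- `m^2` is kept for the conclusion. Also `N ≥ 2` makes the two lowest coefficients vanish.
  set N := M + 2 with hN
  refine ⟨4 ^ N * δ⁻¹ ^ (2 * N) * (2 ^ N * 2 ^ (2 * N)), 2 * N + 2 * N, fun n => ?_⟩
  set T := ((Finset.Icc (n - N) (n + N)).erase n) with hT
  have hcard : T.card ≤ 2 * N := by
    rw [hT, Finset.card_erase_of_mem (Finset.mem_Icc.2 ⟨by omega, by omega⟩), Nat.card_Icc]; omega
  have hmono := strictMono_of_lacunary hr hκ h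
  have hgap : ∀ k, k ≠ n → r * κ n ≤ κ k ∨ r * κ k ≤ κ n := fun k hk => by
    rcases lt_or_gt_of_ne hk with hk | hk
    · exact Or.inr ((h k).trans (hmono.monotone hk))
    · exact Or.inl ((h n).trans (hmono.monotone hk))
  have hw01 : ∀ k, 0 ≤ κ n / (κ n + κ k) ∧ κ n / (κ n + κ k) ≤ 1 := fun k => by
    have := hκ n; have := hκ k
    exact ⟨by positivity, (div_le_one (by positivity)).2 (by linarith)⟩
  obtain ⟨Q, hQd, hQ0, hQB, hQ1, hQT, hQb⟩ := exists_interpolation_polynomial N T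
    (fun k => κ n / (κ n + κ k)) hδ0 (fun k _ => hw01 k)
    (fun k hk => le_abs_half_sub_ratio hr (hκ n) (hκ k) (hgap k (Finset.ne_of_mem_erase hk)))
  have hcardpow : δ⁻¹ ^ T.card ≤ δ⁻¹ ^ (2 * N) := pow_le_pow_right₀ hδ1 hcard
  refine ⟨Q, hQd.trans (by omega), hQ0 0 (by omega), hQ0 1 (by omega), fun i => (hQB i).trans ?_,
    hQ1, fun k hk => ?_⟩
  · gcongr
    · norm_num
  · have hm0 := minRatio_pos (hκ n) (hκ k)
    by_cases hkT : k ∈ T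
    · rw [hQT k hkT, abs_zero]; positivity
    have hfar : minRatio (κ n) (κ k) ≤ r⁻¹ ^ N := by
      rcases lt_or_gt_of_ne hk with hk' | hk'
      · rw [minRatio_comm]
        refine minRatio_le_pow_of_lacunary hr hκ h ?_
        by_contra hcon
        exact hkT (Finset.mem_erase.2 ⟨hk, Finset.mem_Icc.2 ⟨by omega, by omega⟩⟩)
      · refine minRatio_le_pow_of_lacunary hr hκ h ?_
        by_contra hcon
        exact hkT (Finset.mem_erase.2 ⟨hk, Finset.mem_Icc.2 ⟨by omega, by omega⟩⟩)
    set m := minRatio (κ n) (κ k) with hm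
    have hsmall : (4 * δ⁻¹ ^ 2 * r⁻¹ ^ M) ^ N ≤ η := by
      have h1 : 4 * δ⁻¹ ^ 2 * r⁻¹ ^ M ≤ min η 1 := by linarith
      have h2 : 0 ≤ 4 * δ⁻¹ ^ 2 * r⁻¹ ^ M := by positivity
      calc _ ≤ (4 * δ⁻¹ ^ 2 * r⁻¹ ^ M) ^ 1 :=
            pow_le_pow_of_le_one h2 (h1.trans (min_le_right _ _)) (by omega)
        _ ≤ η := by rw [pow_one]; exact h1.trans (min_le_left _ _)
    have hw := hw01 k
    have hw1 := mul_one_sub_ratio_le_minRatio (hκ n) (hκ k)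
    have hw2 : 0 ≤ κ n / (κ n + κ k) * (1 - κ n / (κ n + κ k)) :=
      mul_nonneg hw.1 (by linarith)
    calc |Q.eval (κ n / (κ n + κ k))| ≤ (4 * m) ^ N * δ⁻¹ ^ (2 * N) := by
          refine (hQb _ hw.1 hw.2).trans ?_
          gcongr
      _ = (4 * δ⁻¹ ^ 2) ^ N * m ^ M * m ^ 2 := by
          rw [mul_pow, mul_pow, ← pow_mul, hN, pow_add m]; ring
      _ ≤ (4 * δ⁻¹ ^ 2) ^ N * (r⁻¹ ^ N) ^ M * m ^ 2 := by gcongr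
      _ = (4 * δ⁻¹ ^ 2 * r⁻¹ ^ M) ^ N * m ^ 2 := by
          rw [mul_pow (4 * δ⁻¹ ^ 2) (r⁻¹ ^ M), ← pow_mul, ← pow_mul, mul_comm M N]
      _ ≤ η * m ^ 2 := by gcongr

/-! ### The lower estimate for exponential sums. -/

/-- The functional with kernel `laplaceKernel Q κ` on an exponential sum. -/
theorem enorm_sum_eval_le_lintegral {Q : Polynomial ℝ} (hQ : Q.coeff 0 = 0) {κ₀ : ℝ} (hκ₀ : 0 < κ₀)
    {κ : ℕ → ℝ} (hκ : ∀ n, 0 < κ n) (S : Finset ℕ) (a : ℕ → ℂ) :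
    ‖∑ k ∈ S, a k * ((Q.eval (κ₀ / (κ₀ + κ k)) : ℝ) : ℂ)‖ₑ ≤
      ∫⁻ x in Set.Ioi 0, ‖laplaceKernel Q κ₀ x‖ₑ *
        ‖∑ k ∈ S, a k * (Real.exp (-(κ k * x)) : ℂ)‖ₑ := by
  have hint : ∀ k, IntegrableOn
      (fun x => a k * ((Real.exp (-(κ k * x)) * laplaceKernel Q κ₀ x : ℝ) : ℂ)) (Set.Ioi 0) :=
    fun k => (integrableOn_exp_mul_laplaceKernel Q (add_pos hκ₀ (hκ k))).ofReal.const_mul _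
  have heq : ∑ k ∈ S, a k * ((Q.eval (κ₀ / (κ₀ + κ k)) : ℝ) : ℂ) = ∫ x in Set.Ioi 0,
      (laplaceKernel Q κ₀ x : ℂ) * ∑ k ∈ S, a k * (Real.exp (-(κ k * x)) : ℂ) := by
    calc _ = ∑ k ∈ S, ∫ x in Set.Ioi 0,
          a k * ((Real.exp (-(κ k * x)) * laplaceKernel Q κ₀ x : ℝ) : ℂ) := by
          refine Finset.sum_congr rfl fun k _ => ?_
          rw [integral_const_mul, integral_complex_ofReal,
            integral_exp_mul_laplaceKernel hQ (add_pos hκ₀ (hκ k))]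
      _ = _ := by
          rw [← integral_finsetSum _ fun k _ => hint k]
          congr 1; ext x
          rw [Finset.mul_sum]
          refine Finset.sum_congr rfl fun k _ => ?_
          push_cast; ring
  rw [heq]
  refine (enorm_integral_le_lintegral_enorm _).trans (lintegral_mono fun x => ?_)
  rw [enorm_mul, ← ofReal_norm (laplaceKernel Q κ₀ x : ℂ), Complex.norm_real, ofReal_norm]

/-- For a lacunary sequence `κ`, the exponentials `e^{-κ_k x}` satisfy a lower `ℓ^p` estimate. -/
theorem exists_lower_estimate {r : ℝ} {κ : ℕ → ℝ} (hr : 1 < r) (hκ : ∀ n, 0 < κ n)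
    (h : ∀ n, r * κ n ≤ κ (n + 1)) {p : ℝ} (hp : 1 ≤ p) :
    ∃ A : ℝ≥0, ∀ (S : Finset ℕ) (a : ℕ → ℂ) (ω : ℝ → ℝ≥0∞), Measurable ω →
      (∀ x > 0, ω x ≤ 1) → (∀ x > 0, ω x ≠ 0) →
      ∑ n ∈ S, ‖a n‖ₑ ^ p / ENNReal.ofReal (κ n) ≤
        A * ∫⁻ x in Set.Ioi 0, ω x *
          (‖∑ k ∈ S, a k * (Real.exp (-(κ k * x)) : ℂ)‖ₑ / ω x) ^ p := by
  have hp0 : 0 < p := by linarith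
  set σ : ℝ := 2 * (1 - r⁻¹)⁻¹ with hσ
  have hσ0 : 0 < σ := by
    have := inv_lt_one_of_one_lt₀ hr
    exact mul_pos two_pos (inv_pos.2 (by linarith))
  -- `σ` bounds the row sums of `minRatio`, so this `η` gives Schur bounds `1/2`.
  obtain ⟨B, d, hQ⟩ := exists_almost_biorthogonal hr hκ h (η := (2 * σ)⁻¹) (by positivity)
  choose Q hQd hQ0 hQ1 hQB hQhalf hQfar using hQ
  have hB0 : 0 ≤ B := (abs_nonneg _).trans (hQB 0 0)
  have hK : ∀ n, ∫⁻ x in Set.Ioi 0, ‖laplaceKernel (Q n) (κ n) x‖ₑ ≤ ENNReal.ofReal (B * d) :=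
    fun n => lintegral_enorm_laplaceKernel_le (hQB n) (hQd n) (hκ n)
  have hKsum : ∀ (S : Finset ℕ) (x : ℝ), 0 < x →
      ∑ n ∈ S, ‖laplaceKernel (Q n) (κ n) x‖ₑ / ENNReal.ofReal (κ n) ≤
        ENNReal.ofReal (B * d ^ 2 * σ) := by
    intro S x hx
    calc _ ≤ ∑ n ∈ S, ENNReal.ofReal (B * d ^ 2 * min (κ n * x) (κ n * x)⁻¹) := by
          refine Finset.sum_le_sum fun n _ => ?_
          rw [← ofReal_norm, ← ENNReal.ofReal_div_of_pos (hκ n)]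
          refine ENNReal.ofReal_le_ofReal ?_
          rw [div_le_iff₀ (hκ n)]
          refine (abs_laplaceKernel_le (hQ1 n) (hQB n) (hQd n) (hκ n) hx).trans_eq (by ring)
      _ = ENNReal.ofReal (∑ n ∈ S, B * d ^ 2 * min (κ n * x) (κ n * x)⁻¹) := by
          rw [ENNReal.ofReal_sum_of_nonneg fun n _ => ?_]
          have := mul_pos (hκ n) hx
          exact mul_nonneg (by positivity) (le_min (by positivity) (by positivity))
      _ ≤ _ := by
          refine ENNReal.ofReal_le_ofReal ?_
          rw [← Finset.mul_sum]
          gcongr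
          exact sum_min_le_of_lacunary hr hκ h S hx
  refine ⟨Real.toNNReal (2 ^ p * ((B * d) ^ (p - 1) * (B * d ^ 2 * σ))),
    fun S a ω hω hω1 hω0 => ?_⟩
  set F : ℝ → ℂ := fun x => ∑ k ∈ S, a k * (Real.exp (-(κ k * x)) : ℂ) with hF
  have hFm : Measurable fun x => ‖F x‖ₑ := by
    have : Continuous F := by fun_prop
    exact this.measurable.enorm
  have hKm : ∀ n, Measurable fun x => ‖laplaceKernel (Q n) (κ n) x‖ₑ := fun n =>
    (continuous_laplaceKernel _ _).measurable.enorm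
  set ℓ : ℕ → ℂ := fun n => ∑ k ∈ S, a k * (((Q n).eval (κ n / (κ n + κ k)) : ℝ) : ℂ) with hℓ
  set c : ℕ → ℝ≥0∞ := fun n => ENNReal.ofReal (κ n ^ (-(1 / p))) with hc
  have hcp : ∀ n, c n ^ p = (ENNReal.ofReal (κ n))⁻¹ := fun n => by
    simp only [hc]
    rw [ENNReal.ofReal_rpow_of_nonneg (Real.rpow_nonneg (hκ n).le _) hp0.le,
      ← Real.rpow_mul (hκ n).le, neg_mul, one_div_mul_cancel hp0.ne', Real.rpow_neg_one,
      ENNReal.ofReal_inv_of_pos (hκ n)]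
  -- Hölder with weight `|K_n| ω`, whose mass is at most that of `|K_n|` since `ω ≤ 1`. Summing over
  -- `n` then uses the pointwise bound `hKsum`.
  have hℓbound : ∀ n, ‖ℓ n‖ₑ ^ p ≤ ENNReal.ofReal (B * d) ^ (p - 1) * ∫⁻ x in Set.Ioi 0,
      ‖laplaceKernel (Q n) (κ n) x‖ₑ * (ω x * (‖F x‖ₑ / ω x) ^ p) := by
    intro n
    have h1 : ‖ℓ n‖ₑ ≤ ∫⁻ x in Set.Ioi 0,
        (‖laplaceKernel (Q n) (κ n) x‖ₑ * ω x) * (‖F x‖ₑ / ω x) := by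
      refine (enorm_sum_eval_le_lintegral (hQ0 n) (hκ n) hκ S a).trans
        (setLIntegral_mono' measurableSet_Ioi fun x hx => ?_)
      rw [mul_assoc, ENNReal.mul_div_cancel (hω0 x hx) ((hω1 x hx).trans_lt (by simp)).ne]
    refine (ENNReal.rpow_le_rpow h1 hp0.le).trans
      ((rpow_lintegral_mul_le _ hp (w := fun x => ‖laplaceKernel (Q n) (κ n) x‖ₑ * ω x)
        (f := fun x => ‖F x‖ₑ / ω x) ((hKm n).mul hω) (hFm.div hω)).trans ?_)
    simp only [mul_assoc]
    gcongr ?_ ^ _ * _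
    refine (setLIntegral_mono' measurableSet_Ioi fun x hx => ?_).trans (hK n)
    exact mul_le_of_le_one_right (by simp) (hω1 x hx)
  have hℓsum : ∑ n ∈ S, (‖ℓ n‖ₑ * c n) ^ p ≤ ENNReal.ofReal (B * d) ^ (p - 1) *
      (ENNReal.ofReal (B * d ^ 2 * σ) * ∫⁻ x in Set.Ioi 0, ω x * (‖F x‖ₑ / ω x) ^ p) := by
    have hm : Measurable fun x => ω x * (‖F x‖ₑ / ω x) ^ p := hω.mul ((hFm.div hω).pow_const p)
    calc _ ≤ ∑ n ∈ S, ENNReal.ofReal (B * d) ^ (p - 1) * ∫⁻ x in Set.Ioi 0,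
          (‖laplaceKernel (Q n) (κ n) x‖ₑ / ENNReal.ofReal (κ n)) *
            (ω x * (‖F x‖ₑ / ω x) ^ p) := by
          refine Finset.sum_le_sum fun n _ => ?_
          rw [ENNReal.mul_rpow_of_nonneg _ _ hp0.le, hcp]
          refine (mul_le_mul_left (hℓbound n) _).trans_eq ?_
          rw [mul_assoc, ← lintegral_mul_const _ (f := fun x => ‖laplaceKernel (Q n) (κ n) x‖ₑ *
            (ω x * (‖F x‖ₑ / ω x) ^ p)) ((hKm n).mul hm)]
          simp_rw [div_eq_mul_inv (‖laplaceKernel (Q n) (κ n) _‖ₑ), mul_right_comm]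
      _ = ENNReal.ofReal (B * d) ^ (p - 1) * ∫⁻ x in Set.Ioi 0,
          (∑ n ∈ S, ‖laplaceKernel (Q n) (κ n) x‖ₑ / ENNReal.ofReal (κ n)) *
            (ω x * (‖F x‖ₑ / ω x) ^ p) := by
          rw [← Finset.mul_sum, ← lintegral_finsetSum (f := fun n x =>
            ‖laplaceKernel (Q n) (κ n) x‖ₑ / ENNReal.ofReal (κ n) *
            (ω x * (‖F x‖ₑ / ω x) ^ p)) _ fun n _ => ((hKm n).div_const _).mul hm]
          simp_rw [Finset.sum_mul]
      _ ≤ ENNReal.ofReal (B * d) ^ (p - 1) * ∫⁻ x in Set.Ioi 0,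
          ENNReal.ofReal (B * d ^ 2 * σ) * (ω x * (‖F x‖ₑ / ω x) ^ p) := by
          gcongr _ * ?_
          refine setLIntegral_mono' measurableSet_Ioi fun x hx => ?_
          gcongr
          exact hKsum S x hx
      _ = _ := by rw [lintegral_const_mul _ hm]
  -- One of the two powers of `minRatio` pays for replacing the weight `c n` by `c k`; the other
  -- remains for the row and column sums.
  have hoff : ∀ n k, k ≠ n → ‖(((Q n).eval (κ n / (κ n + κ k)) : ℝ) : ℂ)‖ₑ * c n ≤
      ENNReal.ofReal ((2 * σ)⁻¹ * minRatio (κ n) (κ k)) * c k := by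
    intro n k hkn
    have hm0 := minRatio_pos (hκ n) (hκ k)
    have hn := hκ n
    have hk := hκ k
    simp only [hc]
    rw [← ofReal_norm, ← ENNReal.ofReal_mul (norm_nonneg _), ← ENNReal.ofReal_mul (by positivity),
      Complex.norm_real]
    refine ENNReal.ofReal_le_ofReal ?_
    have h1 : κ n ^ (-(1 / p)) ≤ (minRatio (κ n) (κ k))⁻¹ * κ k ^ (-(1 / p)) := by
      have hratio : (κ k / κ n) ^ (1 / p) ≤ (minRatio (κ n) (κ k))⁻¹ := by
        rcases le_total (κ k) (κ n) with hle | hle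
        · refine (Real.rpow_le_one (by positivity) ((div_le_one hn).2 hle) (by positivity)).trans ?_
          exact (one_le_inv₀ hm0).2 (minRatio_le_one hn hk)
        · refine (Real.rpow_le_rpow_of_exponent_le ((one_le_div hn).2 hle)
            ((div_le_one hp0).2 hp)).trans ?_
          rw [Real.rpow_one, ← inv_div (κ n)]
          exact inv_anti₀ hm0 (min_le_left _ _)
      have : κ n ^ (-(1 / p)) = (κ k / κ n) ^ (1 / p) * κ k ^ (-(1 / p)) := by
        rw [Real.div_rpow hk.le hn.le, Real.rpow_neg hn.le, Real.rpow_neg hk.le]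
        have := (Real.rpow_pos_of_pos hk (1 / p)).ne'
        field_simp
      rw [this]
      gcongr
    calc _ ≤ ((2 * σ)⁻¹ * minRatio (κ n) (κ k) ^ 2) *
          ((minRatio (κ n) (κ k))⁻¹ * κ k ^ (-(1 / p))) := by
          gcongr
          exact hQfar n k hkn
      _ = _ := by field_simp
  have hrow : ∀ n, ∑ k ∈ S, ENNReal.ofReal ((2 * σ)⁻¹ * minRatio (κ k) (κ n)) ≤ 2⁻¹ := by
    intro n
    rw [← ENNReal.ofReal_sum_of_nonneg fun k _ => ?_, ← Finset.mul_sum]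
    · rw [← ENNReal.ofReal_ofNat 2, ← ENNReal.ofReal_inv_of_pos two_pos]
      refine ENNReal.ofReal_le_ofReal ?_
      calc _ ≤ (2 * σ)⁻¹ * σ := by
            gcongr; exact sum_minRatio_le_of_lacunary hr hκ h S (hκ n)
        _ = _ := by field_simp
    · have := minRatio_pos (hκ k) (hκ n)
      positivity
  have hfinal := sum_rpow_le_of_le_add_sum S hp (b := fun n => ‖a n‖ₑ * c n)
    (u := fun n => ‖ℓ n‖ₑ * c n)
    (M := fun n k => ENNReal.ofReal ((2 * σ)⁻¹ * minRatio (κ n) (κ k)))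
    (fun n _ => ENNReal.mul_ne_top (by simp) (by simp [hc]))
    (fun n hn => ?_) (fun n _ => by simpa only [minRatio_comm (κ n)] using hrow n)
    (fun k _ => hrow k)
  · have hb : ∀ n, ‖a n‖ₑ ^ p / ENNReal.ofReal (κ n) = (‖a n‖ₑ * c n) ^ p := fun n => by
      rw [ENNReal.mul_rpow_of_nonneg _ _ hp0.le, hcp, div_eq_mul_inv]
    simp_rw [hb]
    refine hfinal.trans ((mul_le_mul_right hℓsum _).trans_eq ?_)
    rw [← ENNReal.ofReal, ENNReal.ofReal_mul (p := 2 ^ p) (by positivity),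
      ENNReal.ofReal_mul (p := (B * d) ^ (p - 1)) (by positivity),
      ← ENNReal.ofReal_rpow_of_nonneg (by positivity) (by linarith),
      ← ENNReal.ofReal_rpow_of_nonneg (by positivity) (by linarith)]
    simp only [ENNReal.ofReal_ofNat, mul_assoc, hF]
  -- The diagonal entry is `Q n` at `1/2`, that is `1`.
  · have h1 : a n = ℓ n - ∑ k ∈ S.erase n, a k * (((Q n).eval (κ n / (κ n + κ k)) : ℝ) : ℂ) := by
      have : κ n / (κ n + κ n) = 1 / 2 := by have := (hκ n).ne'; field_simp; norm_num
      simp only [hℓ]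
      rw [← Finset.add_sum_erase S _ hn, this, hQhalf]
      simp
    have h2 : ‖a n‖ₑ ≤ ‖ℓ n‖ₑ +
        ∑ k ∈ S.erase n, ‖a k‖ₑ * ‖(((Q n).eval (κ n / (κ n + κ k)) : ℝ) : ℂ)‖ₑ := by
      conv_lhs => rw [h1]
      refine enorm_sub_le.trans ?_
      gcongr
      refine (enorm_sum_le _ _).trans_eq ?_
      simp_rw [enorm_mul]
    calc ‖a n‖ₑ * c n ≤ (‖ℓ n‖ₑ +
          ∑ k ∈ S.erase n, ‖a k‖ₑ * ‖(((Q n).eval (κ n / (κ n + κ k)) : ℝ) : ℂ)‖ₑ) * c n := by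
          gcongr
      _ = ‖ℓ n‖ₑ * c n +
          ∑ k ∈ S.erase n, ‖a k‖ₑ * (‖(((Q n).eval (κ n / (κ n + κ k)) : ℝ) : ℂ)‖ₑ * c n) := by
          rw [add_mul, Finset.sum_mul]; simp_rw [mul_assoc]
      _ ≤ ‖ℓ n‖ₑ * c n + ∑ k ∈ S.erase n,
          ENNReal.ofReal ((2 * σ)⁻¹ * minRatio (κ n) (κ k)) * (‖a k‖ₑ * c k) := by
          gcongr _ + ?_
          refine Finset.sum_le_sum fun k hk => ?_
          rw [mul_left_comm _ ‖a k‖ₑ]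
          exact mul_le_mul_right (hoff n k (Finset.ne_of_mem_erase hk)) _
      _ ≤ _ := by
          gcongr
          exact Finset.erase_subset _ _

/-! ### From exponential sums to Müntz polynomials. -/

theorem muntzPoly_coeFn (q : ℝ≥0∞) (Λ : ℕ → ℝ≥0) (ν : Measure Unit01) [IsFiniteMeasure ν]
    (b : ℕ →₀ ℂ) : muntzPoly q Λ ν b =ᵐ[ν]
      fun t => ∑ n ∈ b.support, b n * monomialFun (Λ n) t := by
  have h : muntzPoly q Λ ν b = ∑ n ∈ b.support, b n • monomialLp q ν (Λ n) := by
    rw [muntzPoly, Finsupp.linearCombination_apply, Finsupp.sum]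
  rw [h]
  refine (Lp.coeFn_finsetSum _ _).trans ?_
  have h2 : ∀ᵐ t ∂ν, ∀ n, (b n • monomialLp q ν (Λ n) : Lp ℂ q ν) t =
      b n * monomialFun (Λ n) t := by
    refine ae_all_iff.2 fun n => ?_
    filter_upwards [Lp.coeFn_smul (b n) (monomialLp q ν (Λ n)),
      (memLp_monomialFun q ν (Λ n)).coeFn_toLp] with t h1 h2
    rw [h1, Pi.smul_apply, monomialLp, h2, smul_eq_mul]
  filter_upwards [h2] with t ht
  simp [ht]

theorem enorm_rpow_eq_lintegral {α : Type*} [MeasurableSpace α] {ν : Measure α} {q : ℝ≥0∞}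
    (h0 : q ≠ 0) (hq : q ≠ ∞) (f : Lp ℂ q ν) :
    ‖f‖ₑ ^ q.toReal = ∫⁻ t, ‖f t‖ₑ ^ q.toReal ∂ν := by
  rw [Lp.enorm_def, eLpNorm_eq_lintegral_rpow_enorm_toReal h0 hq, ← ENNReal.rpow_mul,
    one_div_mul_cancel (ENNReal.toReal_pos h0 hq).ne', ENNReal.rpow_one]

theorem enorm_muntzPoly_rpow {q : ℝ≥0∞} (h0 : q ≠ 0) (hq : q ≠ ∞) (Λ : ℕ → ℝ≥0)
    (ν : Measure Unit01) [IsFiniteMeasure ν] (b : ℕ →₀ ℂ) :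
    ‖muntzPoly q Λ ν b‖ₑ ^ q.toReal =
      ∫⁻ t, ‖∑ n ∈ b.support, b n * monomialFun (Λ n) t‖ₑ ^ q.toReal ∂ν := by
  rw [enorm_rpow_eq_lintegral h0 hq]
  refine lintegral_congr_ae ?_
  filter_upwards [muntzPoly_coeFn q Λ ν b] with t ht
  rw [ht]

theorem lintegral_exp_neg_le (g : ℝ → ℝ≥0∞) :
    ∫⁻ x in Set.Ioi (0 : ℝ), ENNReal.ofReal (Real.exp (-x)) * g (Real.exp (-x)) ≤
      ∫⁻ t : Unit01, g t ∂lebesgue := by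
  have h := lintegral_image_eq_lintegral_abs_deriv_mul (s := Set.Ioi (0 : ℝ))
    (f := fun x => Real.exp (-x)) (f' := fun x => -Real.exp (-x)) measurableSet_Ioi
    (fun x _ => by simpa using ((hasDerivAt_neg x).exp).hasDerivWithinAt)
    (fun x _ y _ hxy => by simpa using hxy) g
  simp only [abs_neg, Real.abs_exp] at h
  rw [← h, lebesgue, lintegral_subtype_comap measurableSet_Ico]
  refine lintegral_mono_set ?_
  rintro _ ⟨x, hx, rfl⟩
  have hx : 0 < x := hx
  exact ⟨(Real.exp_pos _).le, by simpa using hx⟩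

theorem IsQuasiGeometric.exists_ratio {Λ : ℕ → ℝ≥0} (hΛ : IsQuasiGeometric Λ) :
    ∃ r : ℝ, 1 < r ∧ ∀ n, r * (Λ n : ℝ) ≤ Λ (n + 1) := by
  obtain ⟨h0, r, R, hr, h⟩ := hΛ
  refine ⟨r, by exact_mod_cast hr, fun n => ?_⟩
  have := (h n).1
  rw [le_div_iff₀ (h0 n)] at this
  exact_mod_cast this

/-- The Gurariy–Macaev lower estimate: a Müntz polynomial controls its coefficients. -/
theorem exists_sum_le_enorm_muntzPoly {q : ℝ≥0∞} (h1 : 1 ≤ q) (hq : q ≠ ∞) {Λ : ℕ → ℝ≥0}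
    (hΛ : IsQuasiGeometric Λ) : ∃ A : ℝ≥0, ∀ b : ℕ →₀ ℂ,
      ∑ n ∈ b.support, ‖b n‖ₑ ^ q.toReal / (Λ n : ℝ≥0∞) ≤
        A * ‖muntzPoly q Λ lebesgue b‖ₑ ^ q.toReal := by
  have hq0 : q ≠ 0 := (one_pos.trans_le h1).ne'
  have hp : 1 ≤ q.toReal := by simpa using ENNReal.toReal_mono hq h1
  obtain ⟨r, hr, hlac⟩ := hΛ.exists_ratio
  have hpos : ∀ n, (0 : ℝ) < Λ n := fun n => hΛ.1 n
  have hmin : ∀ n, (Λ 0 : ℝ) ≤ Λ n := fun n =>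
    (strictMono_of_lacunary hr hpos hlac).monotone (Nat.zero_le n)
  obtain ⟨l, hl⟩ : ∃ l : ℝ, l = Λ 0 := ⟨_, rfl⟩
  rw [← hl] at hmin
  have hl0 : 0 < l := hl ▸ hpos 0
  -- The Jacobian of `t = e^{-x}` is taken as the weight `ω = e^{-x}`; shifting the exponents by `1`
  -- cancels the division by `ω`. The shifted sequence is lacunary with the ratio found at the
  -- smallest exponent `l`.
  obtain ⟨A, hA⟩ := exists_lower_estimate (r := (r * l + 1) / (l + 1)) (κ := fun n => (Λ n : ℝ) + 1)
    (by rw [one_lt_div (by linarith)]; nlinarith) (fun n => by have := hpos n; positivity)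
    (fun n => by
      rw [div_mul_eq_mul_div, div_le_iff₀ (by linarith)]
      nlinarith [hmin n, hlac n, mul_nonneg (sub_nonneg.2 hr.le) (sub_nonneg.2 (hmin n))]) hp
  refine ⟨Real.toNNReal (1 + l⁻¹) * A, fun b => ?_⟩
  have hterm : ∀ n, ‖b n‖ₑ ^ q.toReal / (Λ n : ℝ≥0∞) ≤ ENNReal.ofReal (1 + l⁻¹) *
      (‖b n‖ₑ ^ q.toReal / ENNReal.ofReal ((Λ n : ℝ) + 1)) := fun n => by
    rw [div_eq_mul_inv, div_eq_mul_inv, mul_left_comm]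
    gcongr
    rw [← ENNReal.ofReal_coe_nnreal, ← ENNReal.ofReal_inv_of_pos (hpos n),
      ← ENNReal.ofReal_inv_of_pos (by linarith [hpos n]), ← ENNReal.ofReal_mul (by positivity)]
    refine ENNReal.ofReal_le_ofReal ?_
    have := hpos n
    rw [← div_eq_mul_inv, le_div_iff₀ (by linarith), mul_add, inv_mul_cancel₀ this.ne', mul_one]
    gcongr
    exact hmin n
  calc _ ≤ ∑ n ∈ b.support, ENNReal.ofReal (1 + l⁻¹) *
        (‖b n‖ₑ ^ q.toReal / ENNReal.ofReal ((Λ n : ℝ) + 1)) :=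
        Finset.sum_le_sum fun n _ => hterm n
    _ ≤ ENNReal.ofReal (1 + l⁻¹) * (A * ∫⁻ x in Set.Ioi 0, ENNReal.ofReal (Real.exp (-x)) *
          (‖∑ k ∈ b.support, b k * (Real.exp (-(((Λ k : ℝ) + 1) * x)) : ℂ)‖ₑ /
            ENNReal.ofReal (Real.exp (-x))) ^ q.toReal) := by
        rw [← Finset.mul_sum]
        gcongr
        refine hA b.support b (fun x => ENNReal.ofReal (Real.exp (-x))) (by fun_prop)
          (fun x hx => ?_) (fun x _ => by simp [Real.exp_pos])
        rw [← ENNReal.ofReal_one]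
        exact ENNReal.ofReal_le_ofReal (Real.exp_le_one_iff.2 (by linarith))
    _ = ENNReal.ofReal (1 + l⁻¹) * (A * ∫⁻ x in Set.Ioi 0, ENNReal.ofReal (Real.exp (-x)) *
          ‖∑ k ∈ b.support, b k * ((Real.exp (-x) ^ (Λ k : ℝ) : ℝ) : ℂ)‖ₑ ^ q.toReal) := by
        congr 3; ext x
        congr 2
        have hsum : ∑ k ∈ b.support, b k * (Real.exp (-(((Λ k : ℝ) + 1) * x)) : ℂ) =
            (∑ k ∈ b.support, b k * ((Real.exp (-x) ^ (Λ k : ℝ) : ℝ) : ℂ)) *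
              (Real.exp (-x) : ℂ) := by
          rw [Finset.sum_mul]
          refine Finset.sum_congr rfl fun k _ => ?_
          rw [mul_assoc, ← Complex.ofReal_mul, ← Real.exp_mul, ← Real.exp_add]
          congr 3; ring
        rw [hsum, enorm_mul, ← ofReal_norm (Real.exp (-x) : ℂ), Complex.norm_real,
          Real.norm_of_nonneg (Real.exp_pos _).le,
          ENNReal.mul_div_cancel_right (by simp [Real.exp_pos]) (by simp)]
    _ ≤ ENNReal.ofReal (1 + l⁻¹) * (A * ‖muntzPoly q Λ lebesgue b‖ₑ ^ q.toReal) := by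
        rw [enorm_muntzPoly_rpow hq0 hq]
        gcongr
        exact lintegral_exp_neg_le
          (fun t => ‖∑ k ∈ b.support, b k * ((t ^ (Λ k : ℝ) : ℝ) : ℂ)‖ₑ ^ q.toReal)
    _ = _ := by rw [ENNReal.coe_mul, mul_assoc]; rfl

/-! ### Integrals bounded by the tail density. -/

theorem limsup_rpow {α : Type*} (l : Filter α) (u : α → ℝ≥0∞) {y : ℝ} (hy : 0 < y) :
    limsup (fun n => u n ^ y) l = limsup u l ^ y :=
  ((ENNReal.orderIsoRpow y hy).limsup_apply (f := l) (u := u)).symm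

theorem measurableSet_tail (ε : ℝ) : MeasurableSet {t : Unit01 | 1 - ε ≤ (t : ℝ)} :=
  measurableSet_le measurable_const measurable_subtype_coe

/-- If `μ([1 - ε, 1)) ≤ s ε` for all `ε`, then the integral of a decreasing function of `1 - t`
against `μ` is at most `s` times its Lebesgue integral. -/
theorem lintegral_antitone_le (μ : Measure Unit01) {s : ℝ≥0∞}
    (hμ : ∀ ε : ℝ, 0 < ε → μ {t | 1 - ε ≤ (t : ℝ)} ≤ s * ENNReal.ofReal ε) {φ : ℝ → ℝ}
    (hφ : AntitoneOn φ (Set.Ioi 0)) (hφ0 : ∀ x > 0, 0 ≤ φ x) (hφm : Measurable φ) :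
    ∫⁻ t, ENNReal.ofReal (φ (1 - t)) ∂μ ≤ s * ∫⁻ x in Set.Ioi 0, ENNReal.ofReal (φ x) := by
  have hpos : ∀ t : Unit01, 0 < 1 - (t : ℝ) := fun t => by linarith [t.2.2]
  have hm1 : Measurable fun t : Unit01 => φ (1 - t) :=
    hφm.comp (measurable_const.sub measurable_subtype_coe)
  rw [lintegral_eq_lintegral_meas_lt μ (Eventually.of_forall fun t => hφ0 _ (hpos t))
      hm1.aemeasurable,
    lintegral_eq_lintegral_meas_lt (volume.restrict (Set.Ioi 0))
      ((ae_restrict_iff' measurableSet_Ioi).2 (Eventually.of_forall hφ0)) hφm.aemeasurable]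
  -- If `s = 0`, then `ε = 1` shows that `μ` vanishes; this case is separate because `0 * ∞ = 0`
  -- would defeat the bound for level sets of infinite length.
  rcases eq_or_ne s 0 with rfl | hs
  · have h0 : μ Set.univ ≤ 0 := by
      have hsub : (Set.univ : Set Unit01) ⊆ {t | 1 - (1 : ℝ) ≤ (t : ℝ)} := fun t _ => by
        simpa using t.2.1
      simpa using (measure_mono hsub).trans (hμ 1 one_pos)
    rw [Measure.measure_univ_eq_zero.1 (le_antisymm h0 zero_le)]
    simp
  have hanti : Antitone fun u => volume.restrict (Set.Ioi 0) {x | u < φ x} :=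
    fun u v huv => measure_mono fun x hx => huv.trans_lt hx
  rw [← lintegral_const_mul s hanti.measurable]
  refine lintegral_mono fun u => ?_
  rw [Measure.restrict_apply (measurableSet_lt measurable_const hφm)]
  set V := volume ({x | u < φ x} ∩ Set.Ioi 0) with hV
  rcases eq_or_ne V ∞ with hVtop | hVtop
  · rw [hVtop, ENNReal.mul_top hs]; exact le_top
  -- A superlevel set of a decreasing function is an initial interval, so its length `V` bounds the
  -- distance to `1` of its points.
  have key : ∀ t : Unit01, u < φ (1 - t) → 1 - (t : ℝ) ≤ V.toReal := fun t ht => by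
    have hsub : Set.Ioc 0 (1 - (t : ℝ)) ⊆ {x | u < φ x} ∩ Set.Ioi 0 := fun x hx =>
      ⟨ht.trans_le (hφ hx.1 (hpos t) hx.2), hx.1⟩
    have := measure_mono (μ := volume) hsub
    rw [Real.volume_Ioc, sub_zero] at this
    exact (ENNReal.ofReal_le_iff_le_toReal hVtop).1 this
  rcases ENNReal.toReal_nonneg (a := V).eq_or_lt with h0 | h0
  · have : {t : Unit01 | u < φ (1 - t)} = ∅ := by
      refine Set.eq_empty_of_forall_notMem fun t ht => ?_
      linarith [key t ht, hpos t]
    rw [this]; simp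
  · refine (measure_mono fun t ht => ?_).trans ((hμ V.toReal h0).trans_eq ?_)
    · have := key t ht
      simp only [Set.mem_ofPred_eq]
      linarith
    · rw [ENNReal.ofReal_toReal hVtop]

theorem rpow_le_exp_neg {t a : ℝ} (ht : 0 ≤ t) (ha : 0 ≤ a) :
    t ^ a ≤ Real.exp (-(a * (1 - t))) := by
  have h : t ≤ Real.exp (-(1 - t)) := by linarith [Real.add_one_le_exp (-(1 - t))]
  refine (Real.rpow_le_rpow ht h ha).trans_eq ?_
  rw [← Real.exp_mul]; ring_nf

theorem rpow_mul_exp_neg_le {s y : ℝ} (hs0 : 0 < s) (hs1 : s ≤ 1) (hy : 0 < y) :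
    y ^ s * Real.exp (-y) ≤ 3 * min (y ^ s) (y ^ s)⁻¹ := by
  have hys : 0 < y ^ s := Real.rpow_pos_of_pos hy s
  rcases min_cases (y ^ s) (y ^ s)⁻¹ with ⟨h, -⟩ | ⟨h, -⟩ <;> rw [h]
  · have := Real.exp_le_one_iff.2 (neg_nonpos.2 hy.le)
    nlinarith
  · rw [← div_eq_mul_inv, le_div_iff₀ hys, Real.exp_neg, mul_right_comm, ← div_eq_mul_inv,
      div_le_iff₀ (Real.exp_pos _)]
    have h1 : y ^ s ≤ max 1 y := by
      rcases le_total y 1 with hy1 | hy1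
      · exact (Real.rpow_le_one hy.le hy1 hs0.le).trans (le_max_left _ _)
      · exact (Real.rpow_le_rpow_of_exponent_le hy1 hs1).trans
          ((Real.rpow_one y).le.trans (le_max_right _ _))
    have h2 := Real.quadratic_le_exp_of_nonneg hy.le
    rcases max_cases 1 y with ⟨h, -⟩ | ⟨h, -⟩ <;> rw [h] at h1 <;> nlinarith

/-- After factoring out `(1-t)^{-1/p}`, the terms depend only on `λ_k (1-t)` and decay on both sides
of `1`; the sequence `λ_k^{1/p}` is lacunary with ratio `r^{1/p}`. -/
theorem exists_tsum_le {Λ : ℕ → ℝ≥0} (hΛ : IsQuasiGeometric Λ) {p : ℝ} (hp : 1 ≤ p) :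
    ∃ G : ℝ, 0 < G ∧ ∀ t : Unit01,
      ∑' k, (Λ k : ℝ≥0∞) ^ (1 / p) * ENNReal.ofReal ((t : ℝ) ^ (Λ k : ℝ)) ≤
        ENNReal.ofReal (G * (1 - t) ^ (-(1 / p))) := by
  have hp0 : 0 < p := by linarith
  have hs0 : 0 < 1 / p := by positivity
  obtain ⟨r, hr, hlac⟩ := hΛ.exists_ratio
  have hpos : ∀ n, (0 : ℝ) < Λ n := fun n => hΛ.1 n
  have hr' : 1 < r ^ (1 / p) := Real.one_lt_rpow hr hs0
  refine ⟨3 * (2 * (1 - (r ^ (1 / p))⁻¹)⁻¹), ?_, fun t => ?_⟩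
  · have := inv_lt_one_of_one_lt₀ hr'
    exact mul_pos three_pos (mul_pos two_pos (inv_pos.2 (by linarith)))
  have hx : 0 < 1 - (t : ℝ) := by linarith [t.2.2]
  rw [ENNReal.tsum_eq_iSup_sum]
  refine iSup_le fun S => ?_
  have hterm : ∀ k, (Λ k : ℝ≥0∞) ^ (1 / p) * ENNReal.ofReal ((t : ℝ) ^ (Λ k : ℝ)) ≤
      ENNReal.ofReal (3 * min ((Λ k : ℝ) ^ (1 / p) * (1 - t) ^ (1 / p))
        ((Λ k : ℝ) ^ (1 / p) * (1 - t) ^ (1 / p))⁻¹ * (1 - t) ^ (-(1 / p))) := fun k => by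
    have hk := hpos k
    rw [← ENNReal.ofReal_coe_nnreal, ENNReal.ofReal_rpow_of_nonneg hk.le hs0.le,
      ← ENNReal.ofReal_mul (by positivity)]
    refine ENNReal.ofReal_le_ofReal ?_
    have h1 := rpow_mul_exp_neg_le hs0 ((div_le_one hp0).2 hp) (mul_pos hk hx)
    rw [Real.mul_rpow hk.le hx.le] at h1
    calc _ ≤ (Λ k : ℝ) ^ (1 / p) * Real.exp (-(Λ k * (1 - t))) := by
          gcongr; exact rpow_le_exp_neg t.2.1 hk.le
      _ = ((Λ k : ℝ) ^ (1 / p) * (1 - t) ^ (1 / p) * Real.exp (-(Λ k * (1 - t)))) *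
          (1 - t) ^ (-(1 / p)) := by
          rw [Real.rpow_neg hx.le]
          have := (Real.rpow_pos_of_pos hx (1 / p)).ne'
          field_simp
      _ ≤ _ := by gcongr
  refine (Finset.sum_le_sum fun k _ => hterm k).trans ?_
  rw [← ENNReal.ofReal_sum_of_nonneg fun k _ => ?_]
  · refine ENNReal.ofReal_le_ofReal ?_
    rw [← Finset.sum_mul, ← Finset.mul_sum]
    gcongr
    refine sum_min_le_of_lacunary hr' (fun n => Real.rpow_pos_of_pos (hpos n) _) (fun n => ?_) S
      (Real.rpow_pos_of_pos hx _)
    rw [← Real.mul_rpow (by linarith) (hpos n).le]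
    exact Real.rpow_le_rpow (mul_nonneg (by linarith) (hpos n).le) (hlac n) hs0.le
  · have := hpos k
    exact mul_nonneg (mul_nonneg three_pos.le (le_min (by positivity) (by positivity)))
      (by positivity)

/-- The integral in the definition of `diagCoeff`. -/
noncomputable def diagIntegral (Λ : ℕ → ℝ≥0) (μ : Measure Unit01) (p : ℝ) (n : ℕ) : ℝ≥0∞ :=
  ∫⁻ t, (Λ n : ℝ≥0∞) ^ (1 / p) * ENNReal.ofReal ((t : ℝ) ^ (Λ n : ℝ)) *
    (∑' k, (Λ k : ℝ≥0∞) ^ (1 / p) * ENNReal.ofReal ((t : ℝ) ^ (Λ k : ℝ))) ^ (p - 1) ∂μ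

theorem measurable_ofReal_rpow (a : ℝ) :
    Measurable fun t : Unit01 => ENNReal.ofReal ((t : ℝ) ^ a) :=
  (measurable_subtype_coe.pow_const a).ennreal_ofReal

/-- This lets the moments be treated as the case `p = 1` of the diagonal integrals. -/
theorem moment_eq_diagIntegral (Λ : ℕ → ℝ≥0) (μ : Measure Unit01) (n : ℕ) :
    moment Λ μ n = diagIntegral Λ μ 1 n := by
  simp only [moment, diagIntegral, div_one, ENNReal.rpow_one, sub_self, ENNReal.rpow_zero, mul_one]
  rw [lintegral_const_mul _ (measurable_ofReal_rpow _)]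

/-- The `p`-th power of the norm of `Λ n ^ (1 / p) • t ^ Λ n` in `L^p(μ)`. -/
noncomputable def powMoment (Λ : ℕ → ℝ≥0) (μ : Measure Unit01) (p : ℝ) (n : ℕ) : ℝ≥0∞ :=
  Λ n * ∫⁻ t, ENNReal.ofReal ((t : ℝ) ^ (Λ n : ℝ)) ^ p ∂μ

theorem powMoment_le_diagIntegral {Λ : ℕ → ℝ≥0} (μ : Measure Unit01) {p : ℝ} (hp : 1 ≤ p)
    (n : ℕ) : powMoment Λ μ p n ≤ diagIntegral Λ μ p n := by
  have hp0 : 0 < p := by linarith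
  rw [powMoment, ← lintegral_const_mul _ ((measurable_ofReal_rpow _).pow_const p)]
  refine lintegral_mono fun t => ?_
  set T := (Λ n : ℝ≥0∞) ^ (1 / p) * ENNReal.ofReal ((t : ℝ) ^ (Λ n : ℝ)) with hT
  have h1 : (Λ n : ℝ≥0∞) * ENNReal.ofReal ((t : ℝ) ^ (Λ n : ℝ)) ^ p = T * T ^ (p - 1) := by
    have : T ^ p = T * T ^ (p - 1) := by
      conv_lhs => rw [← add_sub_cancel 1 p, ENNReal.rpow_add_of_nonneg _ _ one_pos.le (by linarith),
        ENNReal.rpow_one]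
    rw [← this, hT, ENNReal.mul_rpow_of_nonneg _ _ hp0.le, ← ENNReal.rpow_mul,
      one_div_mul_cancel hp0.ne', ENNReal.rpow_one]
  rw [h1]
  gcongr
  exact ENNReal.le_tsum (f := fun k => (Λ k : ℝ≥0∞) ^ (1 / p) *
      ENNReal.ofReal ((t : ℝ) ^ (Λ k : ℝ))) n

/-- The majorant is `λ_n^{1/p} x^{1/p-1} e^{-λ_n x}` up to a constant, with `x = 1 - t`; its
integral is `Γ(1/p)` for every `n`. -/
theorem exists_limsup_diagIntegral_le {Λ : ℕ → ℝ≥0} (hΛ : IsQuasiGeometric Λ) {p : ℝ}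
    (hp : 1 ≤ p) : ∃ C : ℝ≥0, 0 < C ∧ ∀ (μ : Measure Unit01) [IsFiniteMeasure μ],
      limsup (diagIntegral Λ μ p) atTop ≤ C * limsup (tailRatio μ) (𝓝[>] 0) := by
  have hp0 : 0 < p := by linarith
  have hs0 : 0 < 1 / p := by positivity
  obtain ⟨G, hG, hGsum⟩ := exists_tsum_le hΛ hp
  obtain ⟨r, hr, hlac⟩ := hΛ.exists_ratio
  have hpos : ∀ n, (0 : ℝ) < Λ n := fun n => hΛ.1 n
  have hCpos : 0 < G ^ (p - 1) * Real.Gamma (1 / p) :=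
    mul_pos (Real.rpow_pos_of_pos hG _) (Real.Gamma_pos_of_pos hs0)
  refine ⟨Real.toNNReal (G ^ (p - 1) * Real.Gamma (1 / p)), by simpa using hCpos, fun μ _ => ?_⟩
  rw [← ENNReal.ofReal]
  set φ : ℕ → ℝ → ℝ := fun n x =>
    G ^ (p - 1) * (Λ n : ℝ) ^ (1 / p) * (x ^ (1 / p - 1) * Real.exp (-(Λ n * x))) with hφ
  have hφ0 : ∀ n, ∀ x > 0, 0 ≤ φ n x := fun n x hx => by
    have := hpos n
    simp only [hφ]; positivity
  have hφanti : ∀ n, AntitoneOn (φ n) (Set.Ioi 0) := fun n x hx y hy hxy => by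
    have hx : 0 < x := hx
    have := hpos n
    simp only [hφ]
    refine mul_le_mul_of_nonneg_left (mul_le_mul ?_ ?_ (Real.exp_pos _).le (by positivity))
      (by positivity)
    · exact Real.rpow_le_rpow_of_nonpos hx hxy (by linarith [(div_le_one hp0).2 hp])
    · rw [Real.exp_le_exp]; nlinarith
  have hφm : ∀ n, Measurable (φ n) := fun n => by
    simp only [hφ]; fun_prop
  have hφint : ∀ n, ∫⁻ x in Set.Ioi 0, ENNReal.ofReal (φ n x) =
      ENNReal.ofReal (G ^ (p - 1) * Real.Gamma (1 / p)) := fun n => by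
    have hint : IntegrableOn (fun x : ℝ => x ^ (1 / p - 1) * Real.exp (-(Λ n * x)))
        (Set.Ioi 0) := by
      have := integrableOn_rpow_mul_exp_neg_mul_rpow (p := 1) (s := 1 / p - 1) (b := Λ n)
        (by linarith) one_pos (hpos n)
      simpa [neg_mul] using this
    rw [← ofReal_integral_eq_lintegral_ofReal (hint.const_mul _)
      ((ae_restrict_iff' measurableSet_Ioi).2 (Eventually.of_forall (hφ0 n))),
      integral_const_mul, Real.integral_rpow_mul_exp_neg_mul_Ioi hs0 (hpos n)]
    congr 1
    rw [one_div (Λ n : ℝ), Real.inv_rpow (hpos n).le]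
    have := (Real.rpow_pos_of_pos (hpos n) (1 / p)).ne'
    field_simp
  have hle : ∀ n (t : Unit01), (Λ n : ℝ≥0∞) ^ (1 / p) * ENNReal.ofReal ((t : ℝ) ^ (Λ n : ℝ)) *
      (∑' k, (Λ k : ℝ≥0∞) ^ (1 / p) * ENNReal.ofReal ((t : ℝ) ^ (Λ k : ℝ))) ^ (p - 1) ≤
        ENNReal.ofReal (φ n (1 - t)) := fun n t => by
    have hx : 0 < 1 - (t : ℝ) := by linarith [t.2.2]
    have hn := hpos n
    calc _ ≤ (Λ n : ℝ≥0∞) ^ (1 / p) * ENNReal.ofReal (Real.exp (-(Λ n * (1 - t)))) *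
          ENNReal.ofReal (G * (1 - t) ^ (-(1 / p))) ^ (p - 1) := by
          gcongr
          · exact rpow_le_exp_neg t.2.1 hn.le
          · exact hGsum t
      _ = _ := by
          rw [← ENNReal.ofReal_coe_nnreal, ENNReal.ofReal_rpow_of_nonneg hn.le hs0.le,
            ENNReal.ofReal_rpow_of_nonneg (by positivity) (by linarith),
            ← ENNReal.ofReal_mul (by positivity), ← ENNReal.ofReal_mul (by positivity),
            Real.mul_rpow hG.le (by positivity), ← Real.rpow_mul hx.le]
          have : -(1 / p) * (p - 1) = 1 / p - 1 := by field_simp; ring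
          rw [this]
          congr 1
          simp only [hφ]; ring
  have hlim : ∀ x > 0, Tendsto (fun n => ENNReal.ofReal (φ n x)) atTop (𝓝 0) := fun x hx => by
    rw [← ENNReal.ofReal_zero]
    refine ENNReal.tendsto_ofReal ?_
    have h1 := ((tendsto_rpow_mul_exp_neg_mul_atTop_nhds_zero (1 / p) x hx).comp
      (tendsto_atTop_of_lacunary hr hpos hlac)).const_mul (G ^ (p - 1) * x ^ (1 / p - 1))
    rw [mul_zero] at h1
    refine h1.congr fun n => ?_
    simp only [hφ, Function.comp, neg_mul, mul_comm x]; ring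
  set L := limsup (tailRatio μ) (𝓝[>] 0) with hL
  rcases eq_or_ne L ∞ with hLtop | hLtop
  · rw [hLtop, ENNReal.mul_top (by simpa using hCpos)]; exact le_top
  have key : ∀ s, L < s → limsup (diagIntegral Λ μ p) atTop ≤
      ENNReal.ofReal (G ^ (p - 1) * Real.Gamma (1 / p)) * s := by
    intro s hs
    have hev := eventually_lt_of_limsup_lt hs
    obtain ⟨ε₁, hε₁, hε⟩ := mem_nhdsGT_iff_exists_Ioc_subset.1 hev
    have hε₁ : 0 < ε₁ := hε₁
    have htail : ∀ ε, 0 < ε → ε ≤ ε₁ → μ {t | 1 - ε ≤ (t : ℝ)} ≤ s * ENNReal.ofReal ε := by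
      intro ε h0 h1
      have : tailRatio μ ε < s := hε ⟨h0, h1⟩
      exact (ENNReal.div_le_iff (by simpa using h0) (by simp)).1 this.le
    set A : Set Unit01 := {t | 1 - ε₁ ≤ (t : ℝ)} with hA
    -- Restricting to the tail `A` makes the linear bound valid at every scale. Off `A` the majorant
    -- is at most its value at `ε₁`, which tends to `0`.
    have hrestr : ∀ ε : ℝ, 0 < ε →
        μ.restrict A {t | 1 - ε ≤ (t : ℝ)} ≤ s * ENNReal.ofReal ε := by
      intro ε h0
      rcases le_total ε ε₁ with h1 | h1
      · exact (Measure.restrict_apply_le _ _).trans (htail ε h0 h1)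
      · rw [Measure.restrict_apply (measurableSet_tail ε)]
        refine (measure_mono Set.inter_subset_right).trans ((htail ε₁ hε₁ le_rfl).trans ?_)
        gcongr
    have hbound : ∀ n, diagIntegral Λ μ p n ≤
        s * ENNReal.ofReal (G ^ (p - 1) * Real.Gamma (1 / p)) +
          ENNReal.ofReal (φ n ε₁) * μ Set.univ := by
      intro n
      refine (lintegral_mono (hle n)).trans ?_
      rw [← lintegral_add_compl _ (measurableSet_tail ε₁)]
      refine add_le_add ?_ ?_
      · rw [← hφint n]
        exact lintegral_antitone_le _ hrestr (hφanti n) (hφ0 n) (hφm n)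
      · refine (setLIntegral_mono' (g := fun _ => ENNReal.ofReal (φ n ε₁))
          (measurableSet_tail ε₁).compl fun t ht => ?_).trans ?_
        · have ht : (t : ℝ) < 1 - ε₁ := not_le.1 ht
          exact ENNReal.ofReal_le_ofReal (hφanti n hε₁ (show (0 : ℝ) < 1 - t by linarith)
            (by linarith))
        · rw [setLIntegral_const]
          gcongr
          exact Set.subset_univ _
    refine (limsup_le_limsup (Eventually.of_forall hbound)).trans_eq ?_
    refine Tendsto.limsup_eq ?_
    have h1 := ENNReal.Tendsto.mul_const (hlim ε₁ hε₁) (b := μ Set.univ)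
      (Or.inr (measure_ne_top μ _))
    have h2 := h1.const_add (s * ENNReal.ofReal (G ^ (p - 1) * Real.Gamma (1 / p)))
    rw [zero_mul, add_zero] at h2
    rwa [mul_comm _ s]
  have hne : (𝓝[>] L).NeBot := nhdsGT_neBot_of_exists_gt ⟨∞, hLtop.lt_top⟩
  have ht : Tendsto (fun s => ENNReal.ofReal (G ^ (p - 1) * Real.Gamma (1 / p)) * s) (𝓝[>] L)
      (𝓝 (ENNReal.ofReal (G ^ (p - 1) * Real.Gamma (1 / p)) * L)) :=
    ENNReal.Tendsto.const_mul (tendsto_id.mono_left nhdsWithin_le_nhds)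
      (Or.inr ENNReal.ofReal_ne_top)
  exact ge_of_tendsto ht (eventually_nhdsWithin_of_forall key)

/-! ### The tail density bounded by moments. -/

theorem exp_neg_two_le_one_sub_inv_rpow {a : ℝ} (ha : 2 ≤ a) :
    Real.exp (-2) ≤ (1 - a⁻¹) ^ a := by
  have ha0 : 0 < a := by linarith
  have h1 : a⁻¹ ≤ 1 / 2 := by rw [one_div]; exact inv_anti₀ two_pos ha
  have h0 : 0 < a⁻¹ := by positivity
  have h2 : Real.exp (-(2 * a⁻¹)) ≤ 1 - a⁻¹ := by
    rw [Real.exp_neg, inv_le_comm₀ (Real.exp_pos _) (by linarith)]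
    refine le_trans ?_ (Real.add_one_le_exp _)
    rw [inv_le_iff_one_le_mul₀ (by linarith)]
    nlinarith
  calc Real.exp (-2) = Real.exp (-(2 * a⁻¹)) ^ a := by
        rw [← Real.exp_mul]; congr 1; field_simp
    _ ≤ _ := Real.rpow_le_rpow (Real.exp_pos _).le h2 ha0.le

theorem exists_limsup_tailRatio_le {Λ : ℕ → ℝ≥0} (hΛ : IsQuasiGeometric Λ) {p : ℝ}
    (hp : 1 ≤ p) : ∃ C : ℝ≥0, 0 < C ∧ ∀ μ : Measure Unit01,
      limsup (tailRatio μ) (𝓝[>] 0) ≤ C * limsup (powMoment Λ μ p) atTop := by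
  have hp0 : 0 < p := by linarith
  obtain ⟨r, hr, hlac⟩ := hΛ.exists_ratio
  have hpos : ∀ n, (0 : ℝ) < Λ n := fun n => hΛ.1 n
  have htop := tendsto_atTop_of_lacunary hr hpos hlac
  have hmono := (strictMono_of_lacunary hr hpos hlac).monotone
  obtain ⟨r', R, hr', hR⟩ := hΛ.2
  have hR1 : ∀ n, (Λ (n + 1) : ℝ) ≤ R * Λ n := fun n => by
    have := (hR n).2
    rw [div_le_iff₀ (hΛ.1 n)] at this
    exact_mod_cast this
  have hRpos : (0 : ℝ) < R := by
    have := (hpos 1).trans_le (hR1 0)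
    exact pos_of_mul_pos_left this (hpos 0).le
  set E : ℝ := Real.exp (-2) ^ p with hE
  have hE0 : 0 < E := Real.rpow_pos_of_pos (Real.exp_pos _) _
  refine ⟨Real.toNNReal (R * E⁻¹), by simpa using mul_pos hRpos (inv_pos.2 hE0), fun μ => ?_⟩
  rw [← ENNReal.ofReal]
  -- For `ε` between consecutive scales the tail is enlarged to `[1 - 1/λ_n, 1)`, where `t^{λ_n} ≥
  -- e^{-2}`; the upper bound `R` on the ratios pays for the enlargement.
  have hbound : ∀ n, 2 ≤ (Λ n : ℝ) → ∀ ε : ℝ, (Λ (n + 1) : ℝ)⁻¹ < ε → ε ≤ (Λ n : ℝ)⁻¹ →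
      tailRatio μ ε ≤ ENNReal.ofReal (R * E⁻¹) * powMoment Λ μ p n := by
    intro n hn ε hε1 hε2
    have hn0 := hpos n
    have hn1 := hpos (n + 1)
    have hε0 : 0 < ε := (inv_pos.2 hn1).trans hε1
    set A : Set Unit01 := {t | 1 - (Λ n : ℝ)⁻¹ ≤ (t : ℝ)} with hA
    have h1 : ENNReal.ofReal E * μ A ≤ ∫⁻ t, ENNReal.ofReal ((t : ℝ) ^ (Λ n : ℝ)) ^ p ∂μ := by
      rw [← setLIntegral_const]
      refine le_trans (setLIntegral_mono' (measurableSet_tail _) fun t ht => ?_)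
        (setLIntegral_le_lintegral A _)
      have ht : 1 - (Λ n : ℝ)⁻¹ ≤ (t : ℝ) := ht
      rw [ENNReal.ofReal_rpow_of_nonneg (Real.rpow_nonneg t.2.1 _) hp0.le]
      refine ENNReal.ofReal_le_ofReal (Real.rpow_le_rpow (Real.exp_pos _).le ?_ hp0.le)
      refine (exp_neg_two_le_one_sub_inv_rpow hn).trans (Real.rpow_le_rpow ?_ ht hn0.le)
      have := inv_anti₀ two_pos hn
      linarith
    calc tailRatio μ ε ≤ μ A * ENNReal.ofReal (R * Λ n) := by
          rw [tailRatio, div_eq_mul_inv, ← ENNReal.ofReal_inv_of_pos hε0]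
          gcongr
          · intro t ht
            have ht : 1 - ε ≤ (t : ℝ) := ht
            show 1 - (Λ n : ℝ)⁻¹ ≤ (t : ℝ)
            linarith
          · refine le_trans ?_ (hR1 n)
            exact (inv_lt_of_inv_lt₀ hn1 hε1).le
      _ = ENNReal.ofReal (R * E⁻¹) * (Λ n * (ENNReal.ofReal E * μ A)) := by
          rw [← mul_assoc, ← mul_assoc, ← ENNReal.ofReal_coe_nnreal,
            ← ENNReal.ofReal_mul (by positivity), ← ENNReal.ofReal_mul (by positivity), mul_comm]
          congr 2; field_simp
      _ ≤ _ := by rw [powMoment]; gcongr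
  set L := limsup (powMoment Λ μ p) atTop with hL
  rcases eq_or_ne L ∞ with hLtop | hLtop
  · rw [hLtop, ENNReal.mul_top (ENNReal.ofReal_pos.2 (mul_pos hRpos (inv_pos.2 hE0))).ne']
    exact le_top
  have key : ∀ s, L < s → limsup (tailRatio μ) (𝓝[>] 0) ≤ ENNReal.ofReal (R * E⁻¹) * s := by
    intro s hs
    obtain ⟨N, hN⟩ := eventually_atTop.1 ((eventually_lt_of_limsup_lt hs).and
      (htop.eventually_ge_atTop 2))
    have hN0 := hpos N
    refine limsup_le_of_le (by isBoundedDefault) ?_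
    have hmem : Set.Ioo (0 : ℝ) (Λ N : ℝ)⁻¹ ∈ 𝓝[>] (0 : ℝ) := Ioo_mem_nhdsGT (by positivity)
    filter_upwards [hmem] with ε hε
    have hex : ∃ m, ε⁻¹ < (Λ m : ℝ) := (htop.eventually_gt_atTop ε⁻¹).exists
    classical
    have hm := Nat.find_spec hex
    have hNm : N < Nat.find hex := by
      by_contra hcon
      have h1 := hmono (not_lt.1 hcon)
      have h2 := (lt_inv_comm₀ hε.1 hN0).1 hε.2
      simp only at h1
      linarith
    -- The first index with `λ > 1/ε` exceeds `N`, so its predecessor exists and is still at least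
    -- `N`.
    obtain ⟨n, hn⟩ : ∃ n, Nat.find hex = n + 1 := ⟨Nat.find hex - 1, by omega⟩
    have hn' : ¬ ε⁻¹ < (Λ n : ℝ) := Nat.find_min hex (by omega)
    rw [hn] at hm hNm
    have hnn := hN n (by omega)
    refine (hbound n hnn.2 ε (inv_lt_of_inv_lt₀ hε.1 hm) ?_).trans ?_
    · exact (le_inv_comm₀ (hpos n) hε.1).1 (not_lt.1 hn')
    · gcongr
      exact hnn.1.le
  have hne : (𝓝[>] L).NeBot := nhdsGT_neBot_of_exists_gt ⟨∞, hLtop.lt_top⟩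
  have ht : Tendsto (fun s => ENNReal.ofReal (R * E⁻¹) * s) (𝓝[>] L)
      (𝓝 (ENNReal.ofReal (R * E⁻¹) * L)) :=
    ENNReal.Tendsto.const_mul (tendsto_id.mono_left nhdsWithin_le_nhds)
      (Or.inr ENNReal.ofReal_ne_top)
  exact ge_of_tendsto ht (eventually_nhdsWithin_of_forall key)

/-! ### Essential norms and operator norms. -/

theorem essNorm_nonneg {X Y : Type*} [NormedAddCommGroup X] [NormedSpace ℂ X]
    [NormedAddCommGroup Y] [NormedSpace ℂ Y] (S : X →L[ℂ] Y) : 0 ≤ essNorm S := by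
  refine Real.sInf_nonneg ?_
  rintro _ ⟨K, -, rfl⟩
  exact norm_nonneg _

theorem essNorm_le {X Y : Type*} [NormedAddCommGroup X] [NormedSpace ℂ X]
    [NormedAddCommGroup Y] [NormedSpace ℂ Y] (S : X →L[ℂ] Y) {K : X →L[ℂ] Y}
    (hK : IsCompactOperator K) : essNorm S ≤ ‖S - K‖ := by
  refine csInf_le ⟨0, ?_⟩ ⟨K, hK, rfl⟩
  rintro _ ⟨K, -, rfl⟩
  exact norm_nonneg _

theorem le_essNorm {X Y : Type*} [NormedAddCommGroup X] [NormedSpace ℂ X]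
    [NormedAddCommGroup Y] [NormedSpace ℂ Y] (S : X →L[ℂ] Y) {a : ℝ}
    (h : ∀ K : X →L[ℂ] Y, IsCompactOperator K → a ≤ ‖S - K‖) : a ≤ essNorm S := by
  refine le_csInf ⟨_, 0, isCompactOperator_zero, rfl⟩ ?_
  rintro _ ⟨K, hK, rfl⟩
  exact h K hK

theorem isCompactOperator_iff_essNorm_eq_zero {X Y : Type*} [NormedAddCommGroup X]
    [NormedSpace ℂ X] [NormedAddCommGroup Y] [NormedSpace ℂ Y] [CompleteSpace Y] (S : X →L[ℂ] Y) :
    IsCompactOperator S ↔ essNorm S = 0 := by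
  refine ⟨fun h => le_antisymm ((essNorm_le S h).trans_eq (by simp)) (essNorm_nonneg S),
    fun h => ?_⟩
  have hcl : S ∈ closure {f : X →L[ℂ] Y | IsCompactOperator f} := by
    refine Metric.mem_closure_iff.2 fun ε hε => ?_
    have hlt : essNorm S < ε := h ▸ hε
    obtain ⟨_, ⟨K, hK, rfl⟩, hKε⟩ := exists_lt_of_csInf_lt
      (⟨_, 0, isCompactOperator_zero, rfl⟩ : {r : ℝ | ∃ K : X →L[ℂ] Y,
        IsCompactOperator K ∧ r = ‖S - K‖}.Nonempty) hlt
    exact ⟨K, hK, by rwa [dist_eq_norm]⟩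
  rwa [isClosed_setOfPred_isCompactOperator.closure_eq] at hcl

theorem norm_le_of_enorm_rpow_le {E F : Type*} [NormedAddCommGroup E] [NormedAddCommGroup F]
    {x : E} {y : F} {C : ℝ≥0} {p : ℝ} (hp : 0 < p) (h : ‖x‖ₑ ^ p ≤ C * ‖y‖ₑ ^ p) :
    ‖x‖ ≤ (C ^ (1 / p) : ℝ≥0) * ‖y‖ := by
  have h3 := ENNReal.rpow_le_rpow h (by positivity : 0 ≤ 1 / p)
  rw [ENNReal.mul_rpow_of_nonneg _ _ (by positivity), ← ENNReal.rpow_mul, ← ENNReal.rpow_mul,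
    mul_one_div_cancel hp.ne', ENNReal.rpow_one, ENNReal.rpow_one,
    ← ENNReal.coe_rpow_of_nonneg _ (by positivity), enorm_eq_nnnorm, enorm_eq_nnnorm] at h3
  have h4 : ‖x‖₊ ≤ C ^ (1 / p) * ‖y‖₊ := by exact_mod_cast h3
  exact_mod_cast h4

theorem opNorm_le_of_denseRange {ι X Y : Type*} [NormedAddCommGroup X] [NormedSpace ℂ X]
    [NormedAddCommGroup Y] [NormedSpace ℂ Y] {e : ι → X} (he : DenseRange e) (T : X →L[ℂ] Y)
    {C : ℝ} (hC : 0 ≤ C) (h : ∀ b, ‖T (e b)‖ ≤ C * ‖e b‖) : ‖T‖ ≤ C :=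
  T.opNorm_le_bound hC fun x =>
    he.induction_on x (isClosed_le (by fun_prop) (by fun_prop)) h

/-! ### Upper bound for the essential norm. -/

section Upper

variable {q : ℝ≥0∞} [Fact (1 ≤ q)] {Λ : ℕ → ℝ≥0}

theorem exists_coefficient_bound (hq : q ≠ ∞) (hΛ : IsQuasiGeometric Λ) (n : ℕ) :
    ∃ C : ℝ, ∀ b : ℕ →₀ ℂ, ‖b n‖ ≤ C * ‖toMuntzSpace q Λ b‖ := by
  have h1 : 1 ≤ q := Fact.out
  have hp0 : 0 < q.toReal := ENNReal.toReal_pos (one_pos.trans_le h1).ne' hq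
  obtain ⟨A, hA⟩ := exists_sum_le_enorm_muntzPoly h1 hq hΛ
  refine ⟨((Λ n * A) ^ (1 / q.toReal) : ℝ≥0), fun b => ?_⟩
  have hn : (Λ n : ℝ≥0∞) ≠ 0 := by exact_mod_cast (hΛ.1 n).ne'
  have h2 : ‖b n‖ₑ ^ q.toReal ≤ (Λ n * A : ℝ≥0) * ‖muntzPoly q Λ lebesgue b‖ₑ ^ q.toReal := by
    by_cases hb : n ∈ b.support
    · have h3 := (Finset.single_le_sum (f := fun n => ‖b n‖ₑ ^ q.toReal / (Λ n : ℝ≥0∞))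
        (fun _ _ => zero_le) hb).trans (hA b)
      rw [ENNReal.div_le_iff hn (by simp)] at h3
      refine h3.trans_eq ?_
      rw [ENNReal.coe_mul]; ring
    · rw [Finsupp.notMem_support_iff.1 hb, enorm_zero, ENNReal.zero_rpow_of_pos hp0]
      exact zero_le
  exact norm_le_of_enorm_rpow_le hp0 h2

/-- The coefficient functional `∑ n, b n • t ^ Λ n ↦ b n` on the Müntz space. -/
noncomputable def coeffFunctional (q : ℝ≥0∞) [Fact (1 ≤ q)] (Λ : ℕ → ℝ≥0) (n : ℕ) :
    muntzSpace q Λ →L[ℂ] ℂ :=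
  (Finsupp.lapply n : (ℕ →₀ ℂ) →ₗ[ℂ] ℂ).extendOfNorm (toMuntzSpace q Λ)

theorem coeffFunctional_toMuntzSpace (hq : q ≠ ∞) (hΛ : IsQuasiGeometric Λ) (n : ℕ)
    (b : ℕ →₀ ℂ) : coeffFunctional q Λ n (toMuntzSpace q Λ b) = b n :=
  LinearMap.extendOfNorm_eq (denseRange_toMuntzSpace q Λ) (exists_coefficient_bound hq hΛ n) b

/-- The finite rank operator `∑ n, b n • t ^ Λ n ↦ ∑ n < N, b n • t ^ Λ n`. -/
noncomputable def partialEmbedding (q : ℝ≥0∞) [Fact (1 ≤ q)] (Λ : ℕ → ℝ≥0) (μ : Measure Unit01)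
    [IsFiniteMeasure μ] (N : ℕ) : muntzSpace q Λ →L[ℂ] Lp ℂ q μ :=
  ∑ n ∈ Finset.range N, (coeffFunctional q Λ n).smulRight (monomialLp q μ (Λ n))

theorem isCompactOperator_partialEmbedding (μ : Measure Unit01) [IsFiniteMeasure μ] (N : ℕ) :
    IsCompactOperator (partialEmbedding q Λ μ N) := by
  rw [partialEmbedding]
  refine Finset.sum_induction _ (fun K : muntzSpace q Λ →L[ℂ] Lp ℂ q μ => IsCompactOperator K)
    (fun f g hf hg => hf.add hg) isCompactOperator_zero fun n _ => ?_
  exact (isCompactOperator_of_locallyCompactSpace_dom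
    (coeffFunctional q Λ n)).clm_comp (ContinuousLinearMap.toSpanSingleton ℂ (monomialLp q μ (Λ n)))

theorem sub_partialEmbedding_toMuntzSpace (hq : q ≠ ∞) (hΛ : IsQuasiGeometric Λ)
    {μ : Measure Unit01} [IsFiniteMeasure μ] (hμ : IsCarleson q Λ μ) (N : ℕ) (b : ℕ →₀ ℂ) :
    (carlesonEmbedding q Λ μ - partialEmbedding q Λ μ N) (toMuntzSpace q Λ b) =
      muntzPoly q Λ μ (b.filter fun n => N ≤ n) := by
  have h1 : partialEmbedding q Λ μ N (toMuntzSpace q Λ b) =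
      muntzPoly q Λ μ (b.filter fun n => ¬ N ≤ n) := by
    simp only [partialEmbedding, sum_apply, ContinuousLinearMap.smulRight_apply,
      coeffFunctional_toMuntzSpace hq hΛ]
    rw [muntzPoly, Finsupp.linearCombination_apply, Finsupp.sum_of_support_subset
      (s := Finset.range N) _ ?_ (fun n a => a • monomialLp q μ (Λ n)) fun n _ => zero_smul _ _]
    · refine Finset.sum_congr rfl fun n hn => ?_
      rw [Finsupp.filter_apply_pos _ _ (by simpa using hn)]
    · intro n hn
      rw [Finsupp.support_filter, Finset.mem_filter] at hn
      simpa using hn.2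
  rw [sub_apply, carlesonEmbedding_toMuntzSpace hμ, h1, sub_eq_iff_eq_add,
    ← map_add, Finsupp.filter_add_filter_not]

theorem enorm_monomialFun (a : ℝ≥0) (t : Unit01) :
    ‖monomialFun a t‖ₑ = ENNReal.ofReal ((t : ℝ) ^ (a : ℝ)) := by
  rw [← ofReal_norm, monomialFun, Complex.norm_real,
    Real.norm_of_nonneg (Real.rpow_nonneg t.2.1 _)]

/-- Hölder's inequality at each `t` with weights `λ_n^{1/p} t^{λ_n}`; the total weight to the power
`p - 1` is what produces the form of `D_n(p)`. -/
theorem lintegral_rpow_sum_le (Λ : ℕ → ℝ≥0) (hΛ : ∀ n, 0 < Λ n) (μ : Measure Unit01) {p : ℝ}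
    (hp : 1 ≤ p) (S : Finset ℕ) (a : ℕ → ℂ) :
    ∫⁻ t, ‖∑ n ∈ S, a n * monomialFun (Λ n) t‖ₑ ^ p ∂μ ≤
      ∑ n ∈ S, ‖a n‖ₑ ^ p / Λ n * diagIntegral Λ μ p n := by
  have hp0 : 0 < p := by linarith
  set w : ℕ → Unit01 → ℝ≥0∞ := fun n t =>
    (Λ n : ℝ≥0∞) ^ (1 / p) * ENNReal.ofReal ((t : ℝ) ^ (Λ n : ℝ)) with hw
  have hwm : ∀ n, Measurable (w n) := fun n => (measurable_ofReal_rpow _).const_mul _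
  have hL : ∀ n, (Λ n : ℝ≥0∞) ≠ 0 := fun n => by exact_mod_cast (hΛ n).ne'
  have hL' : ∀ n, (Λ n : ℝ≥0∞) ^ (1 / p) ≠ 0 := fun n =>
    (ENNReal.rpow_pos (hL n).bot_lt (by simp)).ne'
  have hL'' : ∀ n, (Λ n : ℝ≥0∞) ^ (1 / p) ≠ ∞ := fun n =>
    ENNReal.rpow_ne_top_of_nonneg (by positivity) (by simp)
  have hmon : ∀ n t, ‖a n * monomialFun (Λ n) t‖ₑ = w n t * (‖a n‖ₑ / (Λ n : ℝ≥0∞) ^ (1 / p)) := by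
    intro n t
    rw [enorm_mul, enorm_monomialFun, hw]
    simp only
    rw [mul_right_comm, ENNReal.mul_div_cancel (hL' n) (hL'' n)]
  have hpow : ∀ n, (‖a n‖ₑ / (Λ n : ℝ≥0∞) ^ (1 / p)) ^ p = ‖a n‖ₑ ^ p / Λ n := fun n => by
    rw [ENNReal.div_rpow_of_nonneg _ _ hp0.le, ← ENNReal.rpow_mul, one_div_mul_cancel hp0.ne',
      ENNReal.rpow_one]
  calc _ ≤ ∫⁻ t, ∑ n ∈ S, ‖a n‖ₑ ^ p / Λ n * (w n t * (∑' k, w k t) ^ (p - 1)) ∂μ := by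
        refine lintegral_mono fun t => ?_
        calc _ ≤ (∑ n ∈ S, w n t * (‖a n‖ₑ / (Λ n : ℝ≥0∞) ^ (1 / p))) ^ p := by
              simp_rw [← hmon]
              gcongr
              exact enorm_sum_le _ _
          _ ≤ (∑ n ∈ S, w n t) ^ (p - 1) * ∑ n ∈ S, w n t * (‖a n‖ₑ ^ p / Λ n) := by
              simp_rw [← hpow]
              exact rpow_sum_mul_le S hp _ _
          _ ≤ (∑' k, w k t) ^ (p - 1) * ∑ n ∈ S, w n t * (‖a n‖ₑ ^ p / Λ n) := by
              gcongr
              exact ENNReal.sum_le_tsum S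
          _ = _ := by
              rw [Finset.mul_sum]
              exact Finset.sum_congr rfl fun n _ => by ring
    _ = _ := by
        have hm : ∀ n, Measurable fun t => w n t * (∑' k, w k t) ^ (p - 1) := fun n =>
          (hwm n).mul ((Measurable.tsum hwm).pow_const _)
        rw [lintegral_finsetSum _ fun n _ => (hm n).const_mul _]
        refine Finset.sum_congr rfl fun n _ => ?_
        rw [lintegral_const_mul _ (hm n)]
        rfl

theorem exists_essNorm_le (hq : q ≠ ∞) (hΛ : IsQuasiGeometric Λ) :
    ∃ C : ℝ≥0, 0 < C ∧ ∀ (μ : Measure Unit01) [IsFiniteMeasure μ], IsCarleson q Λ μ →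
      ENNReal.ofReal (essNorm (carlesonEmbedding q Λ μ)) ≤
        C * limsup (diagIntegral Λ μ q.toReal) atTop ^ (1 / q.toReal) := by
  have h1 : 1 ≤ q := Fact.out
  have hq0 : q ≠ 0 := (one_pos.trans_le h1).ne'
  have hp : 1 ≤ q.toReal := by simpa using ENNReal.toReal_mono hq h1
  have hp0 : 0 < q.toReal := by linarith
  obtain ⟨A, hA⟩ := exists_sum_le_enorm_muntzPoly h1 hq hΛ
  -- `A + 1` rather than `A` keeps the constant positive, so that the bound is trivial when the
  -- limsup is infinite.
  refine ⟨(A + 1) ^ (1 / q.toReal), NNReal.rpow_pos (by positivity), fun μ _ hμ => ?_⟩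
  have key : ∀ s : ℝ≥0, limsup (diagIntegral Λ μ q.toReal) atTop < s →
      ENNReal.ofReal (essNorm (carlesonEmbedding q Λ μ)) ≤
        (((A + 1) * s) ^ (1 / q.toReal) : ℝ≥0) := by
    intro s hs
    obtain ⟨N, hN⟩ := eventually_atTop.1 (eventually_lt_of_limsup_lt hs)
    have hb : ∀ b : ℕ →₀ ℂ, ‖muntzPoly q Λ μ (b.filter fun n => N ≤ n)‖ ≤
        (((A + 1) * s) ^ (1 / q.toReal) : ℝ≥0) * ‖toMuntzSpace q Λ b‖ := by
      intro b
      have h2 : ‖muntzPoly q Λ μ (b.filter fun n => N ≤ n)‖ₑ ^ q.toReal ≤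
          ((A + 1) * s : ℝ≥0) * ‖muntzPoly q Λ lebesgue b‖ₑ ^ q.toReal := by
        rw [enorm_muntzPoly_rpow hq0 hq]
        refine (lintegral_rpow_sum_le Λ hΛ.1 μ hp _ _).trans ?_
        calc _ ≤ ∑ n ∈ b.support with N ≤ n, ‖b n‖ₑ ^ q.toReal / Λ n * s := by
              rw [Finsupp.support_filter]
              refine Finset.sum_le_sum fun n hn => ?_
              have hn := (Finset.mem_filter.1 hn).2
              rw [Finsupp.filter_apply_pos _ _ hn]
              gcongr
              exact (hN n hn).le
          _ ≤ ∑ n ∈ b.support, ‖b n‖ₑ ^ q.toReal / Λ n * s :=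
              Finset.sum_le_sum_of_subset (Finset.filter_subset _ _)
          _ ≤ (A * ‖muntzPoly q Λ lebesgue b‖ₑ ^ q.toReal) * s := by
              rw [← Finset.sum_mul]; gcongr; exact hA b
          _ ≤ (((A + 1 : ℝ≥0) : ℝ≥0∞) * ‖muntzPoly q Λ lebesgue b‖ₑ ^ q.toReal) * s := by
              gcongr
              exact le_self_add
          _ = _ := by rw [ENNReal.coe_mul]; ring
      exact norm_le_of_enorm_rpow_le hp0 h2
    have hop : ‖carlesonEmbedding q Λ μ - partialEmbedding q Λ μ N‖ ≤
        (((A + 1) * s) ^ (1 / q.toReal) : ℝ≥0) := by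
      refine opNorm_le_of_denseRange (denseRange_toMuntzSpace q Λ) _ (NNReal.coe_nonneg _)
        fun b => ?_
      rw [sub_partialEmbedding_toMuntzSpace hq hΛ hμ]
      exact hb b
    have hess : essNorm (carlesonEmbedding q Λ μ) ≤
        ‖carlesonEmbedding q Λ μ - partialEmbedding q Λ μ N‖ :=
      essNorm_le (K := partialEmbedding q Λ μ N) _ (isCompactOperator_partialEmbedding μ N)
    rw [← ENNReal.ofReal_coe_nnreal]
    exact ENNReal.ofReal_le_ofReal (hess.trans hop)
  set L := limsup (diagIntegral Λ μ q.toReal) atTop with hL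
  rcases eq_or_ne L ∞ with hLtop | hLtop
  · rw [hLtop, ENNReal.top_rpow_of_pos (by positivity), ENNReal.mul_top]
    · exact le_top
    · exact_mod_cast (NNReal.rpow_pos (by positivity : 0 < A + 1)).ne'
  have hne : (𝓝[>] L).NeBot := nhdsGT_neBot_of_exists_gt ⟨∞, hLtop.lt_top⟩
  have ht : Tendsto (fun s : ℝ≥0∞ => (((A + 1) ^ (1 / q.toReal) : ℝ≥0) : ℝ≥0∞) * s ^ (1 / q.toReal))
      (𝓝[>] L) (𝓝 ((((A + 1) ^ (1 / q.toReal) : ℝ≥0) : ℝ≥0∞) * L ^ (1 / q.toReal))) :=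
    ENNReal.Tendsto.const_mul
      ((ENNReal.continuous_rpow_const.tendsto L).mono_left nhdsWithin_le_nhds) (Or.inr (by simp))
  refine ge_of_tendsto ht ?_
  filter_upwards [Ioo_mem_nhdsGT hLtop.lt_top] with s hs
  lift s to ℝ≥0 using hs.2.ne
  refine (key s hs.1).trans_eq ?_
  rw [NNReal.mul_rpow, ENNReal.coe_mul, ENNReal.coe_rpow_of_nonneg s (by positivity)]

end Upper

/-! ### Lower bound for the essential norm. -/

theorem lebesgue_tail_le (ε : ℝ) :
    lebesgue {t : Unit01 | 1 - ε ≤ (t : ℝ)} ≤ ENNReal.ofReal ε := by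
  rw [lebesgue, (MeasurableEmbedding.subtype_coe measurableSet_Ico).comap_apply]
  refine (measure_mono (t := Set.Icc (1 - ε) 1) ?_).trans_eq (by simp)
  rintro _ ⟨t, ht, rfl⟩
  exact ⟨ht, t.2.2.le⟩

theorem powMoment_lebesgue_le_one {Λ : ℕ → ℝ≥0} {n : ℕ} (hn : 0 < Λ n) {p : ℝ} (hp : 1 ≤ p) :
    powMoment Λ lebesgue p n ≤ 1 := by
  have hn' : (0 : ℝ) < Λ n := hn
  have hint := integrableOn_pow_mul_exp_neg 0 hn'
  have h1 : ∫⁻ t, ENNReal.ofReal ((t : ℝ) ^ (Λ n : ℝ)) ^ p ∂lebesgue ≤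
      ∫⁻ t : Unit01, ENNReal.ofReal ((fun x => Real.exp (-(Λ n * x))) (1 - t)) ∂lebesgue := by
    refine lintegral_mono fun t => ?_
    have ht : ENNReal.ofReal ((t : ℝ) ^ (Λ n : ℝ)) ≤ 1 := by
      rw [← ENNReal.ofReal_one]
      exact ENNReal.ofReal_le_ofReal (Real.rpow_le_one t.2.1 t.2.2.le hn'.le)
    exact (ENNReal.rpow_le_self_of_le_one ht hp).trans
      (ENNReal.ofReal_le_ofReal (rpow_le_exp_neg t.2.1 hn'.le))
  have h2 := lintegral_antitone_le lebesgue (s := 1)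
    (fun ε _ => by simpa using lebesgue_tail_le ε) (φ := fun x => Real.exp (-(Λ n * x)))
    (fun x _ y _ hxy => Real.exp_le_exp.2 (by nlinarith)) (fun x _ => (Real.exp_pos _).le)
    (by fun_prop)
  have h3 : ∫⁻ x in Set.Ioi 0, ENNReal.ofReal (Real.exp (-(Λ n * x))) = (Λ n : ℝ≥0∞)⁻¹ := by
    have h4 := integral_pow_mul_exp_neg 0 hn'
    simp only [pow_zero, one_mul, Nat.factorial_zero, Nat.cast_one, zero_add, pow_one] at h4 hint
    rw [← ofReal_integral_eq_lintegral_ofReal hint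
      (Eventually.of_forall fun x => (Real.exp_pos _).le), h4, one_div,
      ENNReal.ofReal_inv_of_pos hn', ENNReal.ofReal_coe_nnreal]
  rw [one_mul, h3] at h2
  calc powMoment Λ lebesgue p n ≤ Λ n * (Λ n : ℝ≥0∞)⁻¹ := by
        rw [powMoment]; gcongr; exact h1.trans h2
    _ ≤ 1 := ENNReal.mul_inv_le_one _

/-- The tails decrease to the empty set because the point `1` is excluded. -/
theorem exists_tail_measure_le (μ : Measure Unit01) [IsFiniteMeasure μ] {δ : ℝ≥0∞} (hδ : 0 < δ) :
    ∃ ε : ℝ, 0 < ε ∧ μ {t | 1 - ε ≤ (t : ℝ)} ≤ δ := by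
  have hanti : Antitone fun m : ℕ => {t : Unit01 | 1 - 1 / ((m : ℝ) + 1) ≤ (t : ℝ)} := by
    intro m k hmk t ht
    have ht : 1 - 1 / ((k : ℝ) + 1) ≤ (t : ℝ) := ht
    show 1 - 1 / ((m : ℝ) + 1) ≤ (t : ℝ)
    have : 1 / ((k : ℝ) + 1) ≤ 1 / ((m : ℝ) + 1) := by gcongr
    linarith
  have hemp : ⋂ m : ℕ, {t : Unit01 | 1 - 1 / ((m : ℝ) + 1) ≤ (t : ℝ)} = ∅ := by
    refine Set.eq_empty_of_forall_notMem fun t ht => ?_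
    obtain ⟨m, hm⟩ := exists_nat_one_div_lt (show 0 < 1 - (t : ℝ) by linarith [t.2.2])
    have : 1 - 1 / ((m : ℝ) + 1) ≤ (t : ℝ) := Set.mem_iInter.1 ht m
    linarith
  have h := tendsto_measure_iInter_atTop (μ := μ)
    (fun m : ℕ => (measurableSet_tail (1 / ((m : ℝ) + 1))).nullMeasurableSet) hanti
    ⟨0, measure_ne_top μ _⟩
  rw [hemp, measure_empty] at h
  obtain ⟨m, hm⟩ := (h.eventually (gt_mem_nhds hδ)).exists
  exact ⟨1 / ((m : ℝ) + 1), by positivity, hm.le⟩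

/-- The coefficients of the normalised monomial `Λ n ^ (1 / p) • t ^ Λ n`. -/
noncomputable def normalizedSingle (Λ : ℕ → ℝ≥0) (p : ℝ) (n : ℕ) : ℕ →₀ ℂ :=
  Finsupp.single n (((Λ n : ℝ) ^ (1 / p) : ℝ) : ℂ)

theorem normalizedSingle_coeFn (q : ℝ≥0∞) (Λ : ℕ → ℝ≥0) (ν : Measure Unit01) [IsFiniteMeasure ν]
    (p : ℝ) (n : ℕ) : muntzPoly q Λ ν (normalizedSingle Λ p n) =ᵐ[ν]
      fun t => (((Λ n : ℝ) ^ (1 / p) : ℝ) : ℂ) * monomialFun (Λ n) t := by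
  rw [muntzPoly, normalizedSingle, Finsupp.linearCombination_single]
  filter_upwards [Lp.coeFn_smul (((Λ n : ℝ) ^ (1 / p) : ℝ) : ℂ) (monomialLp q ν (Λ n)),
    (memLp_monomialFun q ν (Λ n)).coeFn_toLp] with t h1 h2
  rw [h1, Pi.smul_apply, monomialLp, h2, smul_eq_mul]

theorem enorm_normalizedSingle_rpow {q : ℝ≥0∞} (h0 : q ≠ 0) (hq : q ≠ ∞) (Λ : ℕ → ℝ≥0)
    (ν : Measure Unit01) [IsFiniteMeasure ν] (n : ℕ) :
    ‖muntzPoly q Λ ν (normalizedSingle Λ q.toReal n)‖ₑ ^ q.toReal = powMoment Λ ν q.toReal n := by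
  have hp0 := ENNReal.toReal_pos h0 hq
  rw [enorm_rpow_eq_lintegral h0 hq, powMoment,
    ← lintegral_const_mul _ ((measurable_ofReal_rpow _).pow_const _)]
  refine lintegral_congr_ae ?_
  filter_upwards [normalizedSingle_coeFn q Λ ν q.toReal n] with t ht
  rw [ht, enorm_mul, enorm_monomialFun, ENNReal.mul_rpow_of_nonneg _ _ hp0.le]
  congr 1
  rw [← ofReal_norm, Complex.norm_real, Real.norm_of_nonneg (by positivity),
    ← ENNReal.ofReal_rpow_of_nonneg (by positivity) (by positivity), ENNReal.ofReal_coe_nnreal,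
    ← ENNReal.rpow_mul, one_div_mul_cancel hp0.ne', ENNReal.rpow_one]

theorem tendsto_eLpNorm_indicator_normalizedSingle (q : ℝ≥0∞) {Λ : ℕ → ℝ≥0}
    (hΛ : IsQuasiGeometric Λ) (μ : Measure Unit01) [IsFiniteMeasure μ] (p : ℝ) {ε : ℝ}
    (hε : 0 < ε) :
    Tendsto (fun n => eLpNorm ({t : Unit01 | 1 - ε ≤ (t : ℝ)}ᶜ.indicator
      (muntzPoly q Λ μ (normalizedSingle Λ p n))) q μ) atTop (𝓝 0) := by
  obtain ⟨r, hr, hlac⟩ := hΛ.exists_ratio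
  have hpos : ∀ n, (0 : ℝ) < Λ n := fun n => hΛ.1 n
  have hbound : ∀ n, eLpNorm ({t : Unit01 | 1 - ε ≤ (t : ℝ)}ᶜ.indicator
      (muntzPoly q Λ μ (normalizedSingle Λ p n))) q μ ≤
        μ Set.univ ^ q.toReal⁻¹ *
          ENNReal.ofReal ((Λ n : ℝ) ^ (1 / p) * Real.exp (-(Λ n * ε))) := by
    intro n
    have hn := hpos n
    refine eLpNorm_le_of_ae_bound ?_
    filter_upwards [normalizedSingle_coeFn q Λ μ p n] with t ht
    rw [Set.indicator_apply]
    split_ifs with hA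
    · have hA : (t : ℝ) < 1 - ε := not_le.1 hA
      rw [ht, norm_mul, Complex.norm_real, monomialFun, Complex.norm_real,
        Real.norm_of_nonneg (Real.rpow_nonneg hn.le _),
        Real.norm_of_nonneg (Real.rpow_nonneg t.2.1 _)]
      gcongr
      refine (rpow_le_exp_neg t.2.1 hn.le).trans (Real.exp_le_exp.2 ?_)
      nlinarith
    · rw [norm_zero]; positivity
  have hlim : Tendsto (fun n => (Λ n : ℝ) ^ (1 / p) * Real.exp (-(Λ n * ε))) atTop (𝓝 0) := by
    refine ((tendsto_rpow_mul_exp_neg_mul_atTop_nhds_zero (1 / p) ε hε).comp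
      (tendsto_atTop_of_lacunary hr hpos hlac)).congr fun n => ?_
    simp only [Function.comp, neg_mul, mul_comm ε]
  have hlim2 := ENNReal.Tendsto.const_mul (a := μ Set.univ ^ q.toReal⁻¹)
    (ENNReal.tendsto_ofReal hlim) (Or.inr
      (ENNReal.rpow_ne_top_of_nonneg (inv_nonneg.2 ENNReal.toReal_nonneg) (measure_ne_top μ _)))
  rw [ENNReal.ofReal_zero, mul_zero] at hlim2
  exact tendsto_of_tendsto_of_tendsto_of_le_of_le tendsto_const_nhds hlim2 (fun _ => zero_le)
    hbound

variable {q : ℝ≥0∞} [Fact (1 ≤ q)] {Λ : ℕ → ℝ≥0}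

theorem enorm_toMuntzSpace_normalizedSingle_le (hq : q ≠ ∞) (hΛ : IsQuasiGeometric Λ) (n : ℕ) :
    ‖toMuntzSpace q Λ (normalizedSingle Λ q.toReal n)‖ₑ ≤ 1 := by
  have h1 : 1 ≤ q := Fact.out
  have hq0 : q ≠ 0 := (one_pos.trans_le h1).ne'
  have hp : 1 ≤ q.toReal := by simpa using ENNReal.toReal_mono hq h1
  have h : ‖muntzPoly q Λ lebesgue (normalizedSingle Λ q.toReal n)‖ₑ ^ q.toReal ≤ 1 :=
    (enorm_normalizedSingle_rpow hq0 hq Λ lebesgue n).trans_le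
      (powMoment_lebesgue_le_one (hΛ.1 n) hp)
  by_contra hcon
  exact absurd h (not_le.2 (ENNReal.one_lt_rpow (not_le.1 hcon) (by linarith)))

/-- Along a subsequence `K e_n` converges to some `g`. Near `1` the function `g` has small norm, and
away from `1` so has `T e_n`; hence `‖T e_n‖` is nearly at most `‖T e_n - g‖`, itself nearly at most
`‖T - K‖`. No weak convergence of `e_n` is needed. -/
theorem limsup_le_enorm_sub (hq : q ≠ ∞) (hΛ : IsQuasiGeometric Λ)
    {μ : Measure Unit01} [IsFiniteMeasure μ] (hμ : IsCarleson q Λ μ)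
    (K : muntzSpace q Λ →L[ℂ] Lp ℂ q μ) (hK : IsCompactOperator K) :
    limsup (fun n => ‖muntzPoly q Λ μ (normalizedSingle Λ q.toReal n)‖ₑ) atTop ≤
      ‖carlesonEmbedding q Λ μ - K‖ₑ := by
  have h1 : 1 ≤ q := Fact.out
  set T := carlesonEmbedding q Λ μ with hT
  set e : ℕ → muntzSpace q Λ := fun n => toMuntzSpace q Λ (normalizedSingle Λ q.toReal n) with he
  have he1 : ∀ n, ‖e n‖ₑ ≤ 1 := enorm_toMuntzSpace_normalizedSingle_le hq hΛ
  have hTe : ∀ n, T (e n) = muntzPoly q Λ μ (normalizedSingle Λ q.toReal n) := fun n =>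
    carlesonEmbedding_toMuntzSpace hμ _
  have hTlim := fun (ε : ℝ) (hε : 0 < ε) =>
    tendsto_eLpNorm_indicator_normalizedSingle q hΛ μ q.toReal hε
  simp_rw [← hTe] at hTlim ⊢
  refine le_of_forall_lt fun a ha => ?_
  obtain ⟨a', haa', ha'⟩ := exists_between ha
  refine haa'.trans_le ?_
  obtain ⟨φ, hφ, hφa⟩ := extraction_of_frequently_atTop (frequently_lt_of_lt_limsup
    (by isBoundedDefault) ha')
  obtain ⟨C, hC, hKC⟩ := hK.image_closedBall_subset_compact
    (f := (K : muntzSpace q Λ →ₗ[ℂ] Lp ℂ q μ)) 1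
  have hmem : ∀ k, K (e (φ k)) ∈ C := fun k => hKC ⟨e (φ k), by
    have := he1 (φ k)
    rw [enorm_eq_nnnorm] at this
    rw [mem_closedBall_zero_iff]
    exact_mod_cast this, rfl⟩
  obtain ⟨g, -, ψ, hψ, hg⟩ := hC.tendsto_subseq hmem
  have hφψ : Tendsto (fun k => φ (ψ k)) atTop atTop :=
    hφ.tendsto_atTop.comp hψ.tendsto_atTop
  refine ENNReal.le_of_forall_pos_le_add fun ε hε _ => ?_
  have hε3 : (0 : ℝ) < ε / 3 := by positivity
  -- Absolute continuity of the `L^q` norm of `g`, applied to a tail of small measure.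
  obtain ⟨δ, hδ, hδg⟩ := (Lp.memLp g).eLpNorm_indicator_le h1 hq hε3
  obtain ⟨ε₁, hε₁, hμε₁⟩ := exists_tail_measure_le μ (ENNReal.ofReal_pos.2 hδ)
  set A : Set Unit01 := {t | 1 - ε₁ ≤ (t : ℝ)} with hA
  have hAm : MeasurableSet A := measurableSet_tail ε₁
  have hgA := hδg A hAm hμε₁
  have hev1 : ∀ᶠ k in atTop, ‖K (e (φ (ψ k))) - g‖ₑ < ENNReal.ofReal (ε / 3) := by
    have := (tendsto_iff_norm_sub_tendsto_zero.1 hg).eventually (gt_mem_nhds hε3)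
    filter_upwards [this] with k hk
    rw [← ofReal_norm]
    exact (ENNReal.ofReal_lt_ofReal_iff hε3).2 hk
  have hev2 := ((hTlim ε₁ hε₁).comp hφψ).eventually
    (gt_mem_nhds (ENNReal.ofReal_pos.2 hε3))
  obtain ⟨k, hk1, hk2⟩ := (hev1.and hev2).exists
  set n := φ (ψ k) with hn
  have hsub : ‖T (e n) - g‖ₑ ≤ ‖T - K‖ₑ + ENNReal.ofReal (ε / 3) := by
    have h2 : T (e n) - g = (T - K) (e n) + (K (e n) - g) := by
      rw [sub_apply]; abel
    rw [h2]
    refine (enorm_add_le _ _).trans (add_le_add ?_ hk1.le)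
    refine ((T - K).le_opENorm (e n)).trans ?_
    exact mul_le_of_le_one_right zero_le (he1 n)
  have hdecomp : ‖T (e n)‖ₑ ≤ ‖T (e n) - g‖ₑ + eLpNorm (A.indicator g) q μ +
      eLpNorm (Aᶜ.indicator (T (e n))) q μ := by
    have hfm := Lp.aestronglyMeasurable (T (e n))
    have hgm := Lp.aestronglyMeasurable g
    have h2 : eLpNorm (T (e n)) q μ ≤ eLpNorm (A.indicator (T (e n))) q μ +
        eLpNorm (Aᶜ.indicator (T (e n))) q μ := by
      conv_lhs => rw [← Set.indicator_self_add_compl A (T (e n) : Unit01 → ℂ)]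
      exact eLpNorm_add_le (hfm.indicator hAm) (hfm.indicator hAm.compl) h1
    have h3 : eLpNorm (A.indicator (T (e n))) q μ ≤
        eLpNorm (T (e n) - g : Lp ℂ q μ) q μ + eLpNorm (A.indicator g) q μ := by
      have h4 : A.indicator (T (e n) : Unit01 → ℂ) =
          A.indicator ((T (e n) : Unit01 → ℂ) - (g : Unit01 → ℂ)) + A.indicator g := by
        rw [← Set.indicator_add', sub_add_cancel]
      rw [h4]
      refine (eLpNorm_add_le ((hfm.sub hgm).indicator hAm) (hgm.indicator hAm) h1).trans ?_
      gcongr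
      refine (eLpNorm_indicator_le _).trans_eq (eLpNorm_congr_ae ?_)
      exact (Lp.coeFn_sub _ _).symm
    rw [Lp.enorm_def, Lp.enorm_def]
    exact h2.trans (by gcongr)
  calc a' ≤ ‖T (e n)‖ₑ := (hφa (ψ k)).le
    _ ≤ ‖T - K‖ₑ + ENNReal.ofReal (ε / 3) + ENNReal.ofReal (ε / 3) + ENNReal.ofReal (ε / 3) := by
        refine hdecomp.trans ?_
        gcongr
        exact hk2.le
    _ = ‖T - K‖ₑ + ε := by
        rw [add_assoc, add_assoc, ← ENNReal.ofReal_add (by positivity) (by positivity),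
          ← ENNReal.ofReal_add (by positivity) (by positivity), ← ENNReal.ofReal_coe_nnreal]
        congr 2; ring

theorem limsup_powMoment_rpow_le_essNorm (hq : q ≠ ∞) (hΛ : IsQuasiGeometric Λ)
    {μ : Measure Unit01} [IsFiniteMeasure μ] (hμ : IsCarleson q Λ μ) :
    limsup (powMoment Λ μ q.toReal) atTop ^ (1 / q.toReal) ≤
      ENNReal.ofReal (essNorm (carlesonEmbedding q Λ μ)) := by
  have hq0 : q ≠ 0 := (one_pos.trans_le (Fact.out : 1 ≤ q)).ne'
  have hp0 := ENNReal.toReal_pos hq0 hq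
  have heq : limsup (powMoment Λ μ q.toReal) atTop ^ (1 / q.toReal) =
      limsup (fun n => ‖muntzPoly q Λ μ (normalizedSingle Λ q.toReal n)‖ₑ) atTop := by
    rw [← limsup_rpow _ _ (by positivity)]
    simp_rw [← enorm_normalizedSingle_rpow hq0 hq, ← ENNReal.rpow_mul,
      mul_one_div_cancel hp0.ne', ENNReal.rpow_one]
  rw [heq]
  set s := limsup (fun n => ‖muntzPoly q Λ μ (normalizedSingle Λ q.toReal n)‖ₑ) atTop with hs
  have hle : ∀ K : muntzSpace q Λ →L[ℂ] Lp ℂ q μ, IsCompactOperator K →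
      s ≤ ENNReal.ofReal ‖carlesonEmbedding q Λ μ - K‖ := fun K hK =>
    (limsup_le_enorm_sub hq hΛ hμ K hK).trans_eq (ofReal_norm _).symm
  -- The compact operator `0` already shows that the limsup is finite.
  have hs_top : s ≠ ∞ := ((hle 0 isCompactOperator_zero).trans_lt ENNReal.ofReal_lt_top).ne
  rw [← ENNReal.ofReal_toReal hs_top]
  refine ENNReal.ofReal_le_ofReal (le_essNorm _ fun K hK => ?_)
  exact ENNReal.toReal_le_of_le_ofReal
    (ContinuousLinearMap.opNorm_nonneg (carlesonEmbedding q Λ μ - K)) (hle K hK)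

/-! ### Assembling the comparisons. -/

theorem Comparable.symm {C : ℝ≥0} {A B : ℝ≥0∞} (h : Comparable C A B) : Comparable C B A :=
  ⟨h.2, h.1⟩

theorem Comparable.trans {C D : ℝ≥0} {A B E : ℝ≥0∞} (h : Comparable C A B)
    (h' : Comparable D B E) : Comparable (C * D) A E := by
  refine ⟨h.1.trans ?_, h'.2.trans ?_⟩
  · rw [ENNReal.coe_mul, mul_assoc]; gcongr; exact h'.1
  · rw [mul_comm C, ENNReal.coe_mul, mul_assoc]; gcongr; exact h.2

theorem Comparable.mono {C D : ℝ≥0} {A B : ℝ≥0∞} (h : Comparable C A B) (hCD : C ≤ D) :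
    Comparable D A B :=
  ⟨h.1.trans (by gcongr), h.2.trans (by gcongr)⟩

theorem Comparable.eq_zero_iff {C : ℝ≥0} {A B : ℝ≥0∞} (h : Comparable C A B) :
    A = 0 ↔ B = 0 := by
  constructor <;> rintro rfl
  · simpa using h.2
  · simpa using h.1

theorem comparable_max {a b : ℝ≥0} {A B : ℝ≥0∞} (h : A ≤ a * B) (h' : B ≤ b * A) :
    Comparable (max a b) A B :=
  ⟨h.trans (by gcongr; exact le_max_left _ _), h'.trans (by gcongr; exact le_max_right _ _)⟩

theorem rpow_le_coe_rpow_mul {C : ℝ≥0} {A B : ℝ≥0∞} {y : ℝ} (hy : 0 ≤ y) (h : A ≤ C * B) :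
    A ^ y ≤ (C ^ y : ℝ≥0) * B ^ y := by
  rw [ENNReal.coe_rpow_of_nonneg _ hy, ← ENNReal.mul_rpow_of_nonneg _ _ hy]
  exact ENNReal.rpow_le_rpow h hy

theorem isVanishingSublinear_iff (μ : Measure Unit01) :
    IsVanishingSublinear μ ↔ limsup (tailRatio μ) (𝓝[>] 0) = 0 :=
  ⟨fun h => h.limsup_eq, fun h => tendsto_of_le_liminf_of_limsup_le zero_le h.le⟩

/-- The tail density and the coefficients `diagCoeff` have comparable upper limits. -/
theorem exists_comparable_limsup_diagIntegral {Λ : ℕ → ℝ≥0} (hΛ : IsQuasiGeometric Λ) {p y : ℝ}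
    (hp : 1 ≤ p) (hy : 0 ≤ y) : ∃ C : ℝ≥0, ∀ (μ : Measure Unit01) [IsFiniteMeasure μ],
      Comparable C (limsup (diagIntegral Λ μ p) atTop ^ y)
        (limsup (tailRatio μ) (𝓝[>] 0) ^ y) := by
  obtain ⟨C₁, -, h₁⟩ := exists_limsup_diagIntegral_le hΛ hp
  obtain ⟨C₂, -, h₂⟩ := exists_limsup_tailRatio_le hΛ hp
  refine ⟨max (C₁ ^ y) (C₂ ^ y), fun μ _ => comparable_max (rpow_le_coe_rpow_mul hy (h₁ μ))
    (rpow_le_coe_rpow_mul hy ((h₂ μ).trans ?_))⟩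
  gcongr
  exact limsup_le_limsup (Eventually.of_forall (powMoment_le_diagIntegral μ hp))

/-- The essential norm is comparable to the upper tail density. -/
theorem exists_comparable_essNorm {q : ℝ≥0∞} [Fact (1 ≤ q)] (hq : q ≠ ∞) {Λ : ℕ → ℝ≥0}
    (hΛ : IsQuasiGeometric Λ) : ∃ C : ℝ≥0, ∀ (μ : Measure Unit01) [IsFiniteMeasure μ],
      IsCarleson q Λ μ →
      Comparable C (ENNReal.ofReal (essNorm (carlesonEmbedding q Λ μ)))
        (limsup (tailRatio μ) (𝓝[>] 0) ^ (1 / q.toReal)) := by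
  have hp : 1 ≤ q.toReal := by simpa using ENNReal.toReal_mono hq (Fact.out : 1 ≤ q)
  have hy : 0 ≤ 1 / q.toReal := by positivity
  obtain ⟨C₁, -, h₁⟩ := exists_limsup_diagIntegral_le hΛ hp
  obtain ⟨C₂, -, h₂⟩ := exists_limsup_tailRatio_le hΛ hp
  obtain ⟨C₃, -, h₃⟩ := exists_essNorm_le hq hΛ
  refine ⟨max (C₃ * C₁ ^ (1 / q.toReal)) (C₂ ^ (1 / q.toReal)), fun μ _ hμ => comparable_max ?_ ?_⟩
  · refine (h₃ μ hμ).trans ?_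
    rw [ENNReal.coe_mul, mul_assoc]
    gcongr
    exact rpow_le_coe_rpow_mul hy (h₁ μ)
  · refine (rpow_le_coe_rpow_mul hy (h₂ μ)).trans ?_
    gcongr
    exact limsup_powMoment_rpow_le_essNorm hq hΛ hμ

end Muntz

theorem mainTheorem8 (q : ℝ≥0∞) [Fact (1 ≤ q)] (hq : q ≠ ∞) (Λ : ℕ → ℝ≥0)
    (hΛ : Muntz.IsQuasiGeometric Λ) :
    ∃ C : ℝ≥0, 0 < C ∧
      ∀ (μ : Measure Muntz.Unit01) [IsFiniteMeasure μ], Muntz.IsCarleson q Λ μ →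
        (Muntz.Comparable C
            (ENNReal.ofReal (Muntz.essNorm (Muntz.carlesonEmbedding q Λ μ)))
            (limsup (fun n => Muntz.moment Λ μ n ^ (1 / q.toReal)) atTop) ∧
          Muntz.Comparable C
            (limsup (fun n => Muntz.moment Λ μ n ^ (1 / q.toReal)) atTop)
            (limsup (Muntz.tailRatio μ) (𝓝[>] 0) ^ (1 / q.toReal)) ∧
          Muntz.Comparable C
            (limsup (Muntz.tailRatio μ) (𝓝[>] 0) ^ (1 / q.toReal))
            (limsup (fun n => Muntz.diagCoeff Λ μ q.toReal n) atTop)) ∧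
        (IsCompactOperator (Muntz.carlesonEmbedding q Λ μ) ↔ Muntz.IsVanishingSublinear μ) := by
  have hp : 1 ≤ q.toReal := by simpa using ENNReal.toReal_mono hq (Fact.out : 1 ≤ q)
  have hy : 0 < 1 / q.toReal := by positivity
  obtain ⟨C₁, h₁⟩ := Muntz.exists_comparable_essNorm hq hΛ
  -- Inner exponent `1` for the moments, with outer power `1/q`.
  obtain ⟨C₂, h₂⟩ := Muntz.exists_comparable_limsup_diagIntegral hΛ le_rfl hy.le
  obtain ⟨C₃, h₃⟩ := Muntz.exists_comparable_limsup_diagIntegral hΛ hp hy.le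
  refine ⟨C₁ * C₂ + C₂ + C₃ + 1, by positivity, fun μ _ hμ => ?_⟩
  have hm : limsup (fun n => Muntz.moment Λ μ n ^ (1 / q.toReal)) atTop =
      limsup (Muntz.diagIntegral Λ μ 1) atTop ^ (1 / q.toReal) := by
    simp_rw [Muntz.moment_eq_diagIntegral]
    exact Muntz.limsup_rpow _ _ hy
  have hd : limsup (fun n => Muntz.diagCoeff Λ μ q.toReal n) atTop =
      limsup (Muntz.diagIntegral Λ μ q.toReal) atTop ^ (1 / q.toReal) :=
    Muntz.limsup_rpow _ _ hy
  rw [hm, hd]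
  refine ⟨⟨?_, ?_, ?_⟩, ?_⟩
  · refine ((h₁ μ hμ).trans (h₂ μ).symm).mono ?_
    rw [add_assoc, add_assoc]; exact le_self_add
  · refine (h₂ μ).mono ?_
    calc C₂ ≤ C₁ * C₂ + C₂ := le_add_self
      _ ≤ C₁ * C₂ + C₂ + C₃ := le_self_add
      _ ≤ _ := le_self_add
  · refine (h₃ μ).symm.mono ?_
    rw [add_right_comm]; exact le_add_self
  -- Compact operators are norm closed, so compactness means zero essential norm, and comparability
  -- transfers this to zero tail density.
  · rw [Muntz.isCompactOperator_iff_essNorm_eq_zero, Muntz.isVanishingSublinear_iff,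
      ← ENNReal.rpow_eq_zero_iff_of_pos hy, ← (h₁ μ hμ).eq_zero_iff, ENNReal.ofReal_eq_zero]
    exact ⟨fun h => h.le, fun h => le_antisymm h (Muntz.essNorm_nonneg _)⟩
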